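/- Let $d\ge 2$ and let $g$ be the Coulomb kernel on $\mathbb{R}^d$: $g(x)=\log\frac{1}{|x|}$ if $d=2$, $g(x)=\frac{1}{(d-2)|x|^{d-2}}$ if $d\ge 3$, and $g(0)=+\infty$. Let $V:\mathbb{R}^d\to\mathbb{R}$ be lower semicontinuous, and suppose that there are $a>0$, $R\in\mathbb{R}$ and $q>1$ such that $V(x)\ge a|x|^q-R$ for all $x\in\mathbb{R}^d$. For $\mu\in\mathcal{P}(\mathbb{R}^d)$ (the Borel probability measures on $\mathbb{R}^d$) let $$\mathcal{E}(\mu)=\iint\Big(g(x-y)+\frac{V(x)+V(y)}{2}\Big)\,\mu(\mathrm{d}x)\,\mu(\mathrm{d}y)\in\mathbb{R}\cup\{+\infty\},\qquad J(\mu)=\iint g(x-y)\,\mu(\mathrm{d}x)\,\mu(\mathrm{d}y)$$ (the latter whenever the integral is defined, in particular if $\mu$ has compact support), and write $(g*\mu)(x)=\int g(x-y)\,\mu(\mathrm{d}y)$ and $\mu(\varphi)=\int\varphi\,\mathrm{d}\mu$. A Borel set has null capacity if it contains no compact set $K$ carrying a probability measure $\mu$ with $\mathrm{supp}(\mu)\subset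 K$ and $J(\mu)<+\infty$; a property holds quasi-everywhere if it holds outside a Borel set of null capacity. Let $p\in(1,q)$, let $\mathcal{P}_p(\mathbb{R}^d)$ be the set of probability measures with finite $p$-th moment, with the topology of the $p$-Wasserstein distance, let $\varphi:\mathbb{R}^d\to\mathbb{R}$ be Lipschitz, and suppose that there are $\mu_-,\mu_+\in\mathcal{P}(\mathbb{R}^d)$ with $\mathcal{E}(\mu_\pm)<+\infty$, $\mu_-(\varphi)<0$ and $\mu_+(\varphi)>0$. Put $$B=\{\nu\in\mathcal{P}_p(\mathbb{R}^d):\nu(\varphi)\le 0\}.$$ Then $B$ is closed in the $p$-Wasserstein topology and, with $\mathring{B}$ its interior in this topology, $$\inf_{\mathring{B}}\mathcal{E}=\inf_{B}\mathcal{E}<+\infty.$$ The energy $\mathcal{E}$ has a unique minimizer $\mu_\star$ over $\mathcal{P}(\mathbb{R}^d)$, and it has compact support (so $\mu_\star\in\mathcal{P}_p(\mathbb{R}^d)$). The energy $\mathcal{E}$ has a unique minimizer $\mu^\varphi$ over $B$, and it has compact support. Moreover there is $\alpha\ge 0$ such that, with the real constant $C_\varphi=\mathcal{E}(\mu^\varphi)+J(\mu^\varphi)$,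 $$\begin{cases}2g*\mu^\varphi+V+\alpha\varphi=C_\varphi & \text{quasi-everywhere in }\mathrm{supp}(\mu^\varphi),\\ 2g*\mu^\varphi+V+\alpha\varphi\ge C_\varphi & \text{quasi-everywhere in }\mathbb{R}^d,\end{cases}$$ and one of the following two alternatives holds: - $\mu_\star\in B$ and $\alpha=0$; - $\mu_\star\notin B$, $\mu^\varphi(\varphi)=0$ and $\alpha>0$. -/

import Mathlib

open MeasureTheory Set
open scoped ENNReal NNReal

noncomputable section

namespace CoulombGas

/-- The physical space `ℝ^d` with the Euclidean norm. -/
abbrev Space (d : ℕ) : Type := EuclideanSpace ℝ (Fin d)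

/-- The extended integral `∫ f⁺ dm - ∫ f⁻ dm` of an extended-real function. All integrands to which
it is applied below have at least one of the two parts with finite integral. -/
def extIntegral {Ω : Type*} [MeasurableSpace Ω] (m : Measure Ω) (f : Ω → EReal) : EReal :=
  ((∫⁻ x, (f x).toENNReal ∂m : ℝ≥0∞) : EReal) - ((∫⁻ x, (-f x).toENNReal ∂m : ℝ≥0∞) : EReal)

/-- The Coulomb kernel `g` of `ℝ^d`, `d ≥ 2`, with the value `+∞` at the origin. -/
def kernel (d : ℕ) (x : Space d) : EReal :=
  if x = 0 then ⊤
  else if d = 2 then ((Real.log (1 / ‖x‖) : ℝ) : EReal)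
  else ((1 / (((d : ℝ) - 2) * ‖x‖ ^ (d - 2)) : ℝ) : EReal)

/-- The potential `g * μ`. -/
def potential {d : ℕ} (μ : ProbabilityMeasure (Space d)) (x : Space d) : EReal :=
  extIntegral (μ : Measure (Space d)) (fun y => kernel d (x - y))

/-- The interaction energy `J(μ) = ∬ g(x - y) μ(dx) μ(dy)`. -/
def interaction {d : ℕ} (μ : ProbabilityMeasure (Space d)) : EReal :=
  extIntegral ((μ : Measure (Space d)).prod (μ : Measure (Space d)))
    (fun z => kernel d (z.1 - z.2))

/-- The electrostatic energy `𝓔(μ)` with confining potential `V`. -/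
def energy {d : ℕ} (V : Space d → ℝ) (μ : ProbabilityMeasure (Space d)) : EReal :=
  extIntegral ((μ : Measure (Space d)).prod (μ : Measure (Space d)))
    (fun z => kernel d (z.1 - z.2) + (((V z.1 + V z.2) / 2 : ℝ) : EReal))

/-- `A` has positive capacity: it contains a compact set carrying a probability measure of finite
interaction energy. -/
def HasPositiveCapacity {d : ℕ} (A : Set (Space d)) : Prop :=
  ∃ K : Set (Space d), IsCompact K ∧ K ⊆ A ∧
    ∃ μ : ProbabilityMeasure (Space d),
      (μ : Measure (Space d)).support ⊆ K ∧ interaction μ < ⊤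

/-- `P` holds quasi-everywhere: outside a Borel set of null capacity. -/
def QuasiEverywhere {d : ℕ} (P : Space d → Prop) : Prop :=
  ∃ N : Set (Space d), MeasurableSet N ∧ ¬ HasPositiveCapacity N ∧ ∀ x, x ∉ N → P x

/-- The set `𝓟_p(ℝ^d)` of probability measures with finite `p`-th moment. -/
def PSpace (d : ℕ) (p : ℝ) : Type :=
  {μ : ProbabilityMeasure (Space d) // ∫⁻ x, ‖x‖ₑ ^ p ∂(μ : Measure (Space d)) < ⊤}

/-- The underlying probability measure of an element of `𝓟_p(ℝ^d)`. -/
def PSpace.toProb {d : ℕ} {p : ℝ} (μ : PSpace d p) : ProbabilityMeasure (Space d) := μ.1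

/-- The underlying measure of an element of `𝓟_p(ℝ^d)`. -/
def PSpace.meas {d : ℕ} {p : ℝ} (μ : PSpace d p) : Measure (Space d) :=
  (μ.toProb : Measure (Space d))

/-- The set `Π(μ, ν)` of couplings of `μ` and `ν`. -/
def couplings {d : ℕ} (μ ν : Measure (Space d)) : Set (Measure (Space d × Space d)) :=
  {π | π.map Prod.fst = μ ∧ π.map Prod.snd = ν}

/-- The `p`-Wasserstein distance. -/
def wasserstein {d : ℕ} {p : ℝ} (μ ν : PSpace d p) : ℝ≥0∞ :=
  (⨅ π ∈ couplings μ.meas ν.meas, ∫⁻ z, ‖z.1 - z.2‖ₑ ^ p ∂π) ^ (1 / p)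

/-- The `p`-Wasserstein topology on `𝓟_p(ℝ^d)`: a set is open when it contains a Wasserstein ball
of positive radius around each of its points. -/
instance wassersteinTopology (d : ℕ) (p : ℝ) : TopologicalSpace (PSpace d p) where
  IsOpen U := ∀ μ ∈ U, ∃ ε : ℝ≥0∞, 0 < ε ∧ ∀ ν, wasserstein μ ν < ε → ν ∈ U
  isOpen_univ := fun _ _ => ⟨1, one_pos, fun _ _ => mem_univ _⟩
  isOpen_inter := by
    intro s t hs ht μ hμ
    obtain ⟨ε, hε, h⟩ := hs μ hμ.1
    obtain ⟨δ, hδ, h'⟩ := ht μ hμ.2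
    exact ⟨min ε δ, lt_min hε hδ, fun ν hν =>
      ⟨h ν (hν.trans_le (min_le_left _ _)), h' ν (hν.trans_le (min_le_right _ _))⟩⟩
  isOpen_sUnion := by
    intro S hS μ hμ
    obtain ⟨s, hs, hμs⟩ := hμ
    obtain ⟨ε, hε, h⟩ := hS s hs μ hμs
    exact ⟨ε, hε, fun ν hν => ⟨s, hs, h ν hν⟩⟩

/-- The constraint set `B = {ν ∈ 𝓟_p(ℝ^d) : ν(φ) ≤ 0}`. -/
def constraintSet {d : ℕ} (p : ℝ) (φ : Space d → ℝ) : Set (PSpace d p) :=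
  {ν | ∫ x, φ x ∂ν.meas ≤ 0}

/-- The infimum of the energy over a subset of `𝓟_p(ℝ^d)`. -/
def infEnergy {d : ℕ} {p : ℝ} (V : Space d → ℝ) (A : Set (PSpace d p)) : EReal :=
  ⨅ ν ∈ A, energy V ν.toProb

/-- The set of minimizers of the energy over a subset of `𝓟_p(ℝ^d)`. -/
def minimizers {d : ℕ} {p : ℝ} (V : Space d → ℝ) (A : Set (PSpace d p)) : Set (PSpace d p) :=
  {μ | μ ∈ A ∧ energy V μ.toProb = infEnergy V A}

/-- The set of minimizers of the energy over all probability measures of `ℝ^d`. -/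
def equilibriumMeasures {d : ℕ} (V : Space d → ℝ) : Set (ProbabilityMeasure (Space d)) :=
  {μ | ∀ ν, energy V μ ≤ energy V ν}

end CoulombGas

end

noncomputable section

namespace CoulombGas

open Filter Topology ComplexConjugate

/-- The Coulomb kernel as a function of the squared distance to the origin. -/
def radialKernel (d : ℕ) (r : ℝ) : ℝ :=
  if d = 2 then -(1 / 2) * Real.log r
  else 1 / (((d : ℝ) - 2) * r ^ (((d : ℝ) - 2) / 2))

lemma radialKernel_two (r : ℝ) : radialKernel 2 r = -(1 / 2) * Real.log r := by
  simp [radialKernel]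

lemma radialKernel_of_ne_two {d : ℕ} (hd : d ≠ 2) (r : ℝ) :
    radialKernel d r = 1 / (((d : ℝ) - 2) * r ^ (((d : ℝ) - 2) / 2)) := by
  simp [radialKernel, hd]

lemma two_lt_cast {d : ℕ} (hd : 2 ≤ d) (h : d ≠ 2) : (0 : ℝ) < (d : ℝ) - 2 := by
  have : (3 : ℝ) ≤ d := by exact_mod_cast (by omega : 3 ≤ d)
  linarith

lemma kernel_eq_radialKernel {d : ℕ} (hd : 2 ≤ d) {x : Space d} (hx : x ≠ 0) :
    kernel d x = (radialKernel d (‖x‖ ^ 2) : ℝ) := by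
  have hx' : 0 < ‖x‖ := norm_pos_iff.2 hx
  by_cases h : d = 2
  · subst h
    simp only [kernel, hx, if_false, if_true, radialKernel_two]
    congr 1
    rw [one_div, Real.log_inv, Real.log_pow]
    push_cast
    ring
  · simp only [kernel, hx, if_false, h, radialKernel_of_ne_two h]
    congr 3
    rw [← Real.rpow_natCast_mul hx'.le, ← Real.rpow_natCast]
    congr 1
    rw [Nat.cast_sub hd]
    push_cast
    ring

lemma radialKernel_antitoneOn {d : ℕ} (hd : 2 ≤ d) : AntitoneOn (radialKernel d) (Ioi 0) := by
  intro r hr s hs hrs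
  rw [mem_Ioi] at hr hs
  by_cases h : d = 2
  · subst h
    simp only [radialKernel_two]
    have := Real.log_le_log hr hrs
    linarith
  · simp only [radialKernel_of_ne_two h]
    have h2 := two_lt_cast hd h
    have : r ^ (((d : ℝ) - 2) / 2) ≤ s ^ (((d : ℝ) - 2) / 2) :=
      Real.rpow_le_rpow hr.le hrs (by positivity)
    have h3 : 0 < r ^ (((d : ℝ) - 2) / 2) := Real.rpow_pos_of_pos hr _
    gcongr

lemma continuousOn_radialKernel {d : ℕ} (hd : 2 ≤ d) : ContinuousOn (radialKernel d) (Ioi 0) := by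
  by_cases h : d = 2
  · subst h
    have : radialKernel 2 = fun r => -(1 / 2) * Real.log r := funext radialKernel_two
    rw [this]
    exact continuousOn_const.mul (Real.continuousOn_log.mono fun r hr => ne_of_gt hr)
  · have : radialKernel d = fun r : ℝ => 1 / (((d : ℝ) - 2) * r ^ (((d : ℝ) - 2) / 2)) :=
      funext (radialKernel_of_ne_two h)
    rw [this]
    have h2 := two_lt_cast hd h
    refine continuousOn_const.div (continuousOn_const.mul
      (continuousOn_id.rpow_const fun r hr => Or.inl (ne_of_gt hr))) fun r hr => ?_
    have : 0 < r ^ (((d : ℝ) - 2) / 2) := Real.rpow_pos_of_pos hr _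
    exact (mul_pos h2 this).ne'

lemma tendsto_radialKernel_zero {d : ℕ} (hd : 2 ≤ d) :
    Tendsto (radialKernel d) (𝓝[>] 0) atTop := by
  by_cases h : d = 2
  · subst h
    have : radialKernel 2 = fun r => -(1 / 2) * Real.log r := funext radialKernel_two
    rw [this]
    exact Real.tendsto_log_nhdsGT_zero.const_mul_atBot_of_neg (by norm_num)
  · have h2 := two_lt_cast hd h
    have : radialKernel d = fun r : ℝ => (((d : ℝ) - 2) * r ^ (((d : ℝ) - 2) / 2))⁻¹ := by
      funext r
      rw [radialKernel_of_ne_two h, one_div]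
    rw [this]
    refine Tendsto.comp tendsto_inv_nhdsGT_zero ?_
    refine tendsto_nhdsWithin_iff.2 ⟨?_, ?_⟩
    · have hc : Continuous fun r : ℝ => ((d : ℝ) - 2) * r ^ (((d : ℝ) - 2) / 2) :=
        continuous_const.mul (Real.continuous_rpow_const (by positivity))
      have := hc.tendsto 0
      rw [Real.zero_rpow (by positivity), mul_zero] at this
      exact this.mono_left nhdsWithin_le_nhds
    · filter_upwards [self_mem_nhdsWithin] with r hr
      have : 0 < r ^ (((d : ℝ) - 2) / 2) := Real.rpow_pos_of_pos hr _
      rw [mem_Ioi]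
      positivity

lemma neg_half_log_le_radialKernel {d : ℕ} (hd : 2 ≤ d) {r s : ℝ} (hr : 0 < r) (hrs : r ≤ s)
    (hs : 1 ≤ s) : -(1 / 2) * Real.log s ≤ radialKernel d r := by
  by_cases h : d = 2
  · subst h
    rw [radialKernel_two]
    have := Real.log_le_log hr hrs
    linarith
  · have h2 := two_lt_cast hd h
    have h3 : 0 < r ^ (((d : ℝ) - 2) / 2) := Real.rpow_pos_of_pos hr _
    rw [radialKernel_of_ne_two h]
    have := Real.log_nonneg hs
    have : 0 ≤ 1 / (((d : ℝ) - 2) * r ^ (((d : ℝ) - 2) / 2)) := by positivity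
    linarith

lemma exp_sub_exp_div_bounds {a b t : ℝ} (hab : a ≤ b) (ht : 0 < t) :
    0 ≤ (Real.exp (-(a * t)) - Real.exp (-(b * t))) * t⁻¹ ∧
      (Real.exp (-(a * t)) - Real.exp (-(b * t))) * t⁻¹ ≤ (b - a) * Real.exp (-(a * t)) := by
  have h1 : Real.exp (-(b * t)) ≤ Real.exp (-(a * t)) :=
    Real.exp_le_exp.2 (by nlinarith)
  refine ⟨mul_nonneg (by linarith) (by positivity), ?_⟩
  rw [mul_inv_le_iff₀ ht]
  have h2 : Real.exp (-(b * t)) = Real.exp (-(a * t)) * Real.exp (-((b - a) * t)) := by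
    rw [← Real.exp_add]; congr 1; ring
  have h3 := Real.add_one_le_exp (-((b - a) * t))
  have h4 := Real.exp_pos (-(a * t))
  rw [h2]
  nlinarith

lemma integrableOn_exp_sub_exp_div {a b : ℝ} (ha : 0 < a) (hab : a ≤ b) :
    IntegrableOn (fun t => (Real.exp (-(a * t)) - Real.exp (-(b * t))) * t⁻¹) (Ioi 0) := by
  have h1 : IntegrableOn (fun t => (b - a) * Real.exp (-(a * t))) (Ioi 0) := by
    have := (integrableOn_exp_mul_Ioi (neg_lt_zero.2 ha) 0).const_mul (b - a)
    simp only [neg_mul] at this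
    exact this
  refine Integrable.mono' h1 (by fun_prop) ?_
  refine (ae_restrict_iff' measurableSet_Ioi).2 (ae_of_all _ fun t ht => ?_)
  obtain ⟨h2, h3⟩ := exp_sub_exp_div_bounds hab ht
  rwa [Real.norm_of_nonneg h2]

lemma integrableOn_exp_sub_exp_neg_div {r : ℝ} (hr : 0 < r) :
    IntegrableOn (fun t => (Real.exp (-(r * t)) - Real.exp (-t)) * t⁻¹) (Ioi 0) := by
  rcases le_total r 1 with h | h
  · simpa using integrableOn_exp_sub_exp_div hr h
  · have := (integrableOn_exp_sub_exp_div one_pos h).neg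
    refine this.congr (ae_of_all _ fun t => ?_)
    simp only [Pi.neg_apply, one_mul]
    ring

lemma integral_exp_sub_exp_neg_div {r : ℝ} (hr : 0 < r) :
    ∫ t in Ioi 0, (Real.exp (-(r * t)) - Real.exp (-t)) * t⁻¹ = -Real.log r := by
  have hc : Continuous fun x : ℝ => Real.exp (-x) := by fun_prop
  have key := Frullani.integral_Ioi_eq (f := fun x : ℝ => Real.exp (-x)) (a := r) (b := 1)
    (L := 1) (R := 0) (hc.locallyIntegrable.locallyIntegrableOn _) hr one_pos
    (by
      have := hc.tendsto 0
      simp only [neg_zero, Real.exp_zero] at this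
      exact this.mono_left nhdsWithin_le_nhds)
    (Real.tendsto_exp_neg_atTop_nhds_zero)
    (by
      refine (integrableOn_exp_sub_exp_neg_div hr).congr (ae_of_all _ fun t => ?_)
      simp [mul_comm])
  simp only [one_mul, smul_eq_mul, sub_zero, mul_one, one_div, Real.log_inv] at key
  rw [← key]
  exact integral_congr_ae (ae_of_all _ fun t => mul_comm _ _)

/-- `radialKernel d` is the superposition of the exponentials `exp (-(r * t))` with weight `w`,
renormalised by a function `e` independent of `r`; for fixed `r` the integrand has a constant
sign. -/
def IsLaplaceRepresentation (d : ℕ) (w e : ℝ → ℝ) : Prop :=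
  Measurable w ∧ Measurable e ∧ (∀ t, 0 < t → 0 < w t) ∧ ∀ r, 0 < r →
    IntegrableOn (fun t => (Real.exp (-(r * t)) - e t) * w t) (Ioi 0) ∧
    ∫ t in Ioi 0, (Real.exp (-(r * t)) - e t) * w t = radialKernel d r ∧
    ∫ t in Ioi 0, |(Real.exp (-(r * t)) - e t) * w t| = |radialKernel d r|

lemma exists_laplace_representation {d : ℕ} (hd : 2 ≤ d) :
    ∃ w e : ℝ → ℝ, IsLaplaceRepresentation d w e := by
  suffices H : ∃ w e : ℝ → ℝ, Measurable w ∧ Measurable e ∧ (∀ t, 0 < t → 0 < w t) ∧ ∀ r, 0 < r →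
      IntegrableOn (fun t => (Real.exp (-(r * t)) - e t) * w t) (Ioi 0) ∧
      ∫ t in Ioi 0, (Real.exp (-(r * t)) - e t) * w t = radialKernel d r ∧
      ((∀ t, 0 < t → e t ≤ Real.exp (-(r * t))) ∨ ∀ t, 0 < t → Real.exp (-(r * t)) ≤ e t) by
    obtain ⟨w, e, hw, he, hpos, h⟩ := H
    refine ⟨w, e, hw, he, hpos, fun r hr => ?_⟩
    obtain ⟨h1, h2, h3⟩ := h r hr
    refine ⟨h1, h2, ?_⟩
    rw [← h2]
    rcases h3 with h3 | h3
    · have hn : ∀ t ∈ Ioi (0 : ℝ), 0 ≤ (Real.exp (-(r * t)) - e t) * w t := fun t ht =>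
        mul_nonneg (sub_nonneg.2 (h3 t ht)) (hpos t ht).le
      rw [abs_of_nonneg (setIntegral_nonneg measurableSet_Ioi hn)]
      exact setIntegral_congr_fun measurableSet_Ioi fun t ht => abs_of_nonneg (hn t ht)
    · have hn : ∀ t ∈ Ioi (0 : ℝ), (Real.exp (-(r * t)) - e t) * w t ≤ 0 := fun t ht =>
        mul_nonpos_of_nonpos_of_nonneg (sub_nonpos.2 (h3 t ht)) (hpos t ht).le
      rw [abs_of_nonpos (setIntegral_nonpos measurableSet_Ioi hn), ← integral_neg]
      exact setIntegral_congr_fun measurableSet_Ioi fun t ht => abs_of_nonpos (hn t ht)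
  by_cases h : d = 2
  · subst h
    refine ⟨fun t => t⁻¹ * (1 / 2), fun t => Real.exp (-t), by fun_prop, by fun_prop,
      fun t ht => by positivity, fun r hr => ⟨?_, ?_, ?_⟩⟩
    · refine ((integrableOn_exp_sub_exp_neg_div hr).mul_const (1 / 2)).congr
        (ae_of_all _ fun t => ?_)
      ring
    · simp_rw [← mul_assoc]
      rw [integral_mul_const, integral_exp_sub_exp_neg_div hr, radialKernel_two]
      ring
    · rcases le_total r 1 with h | h
      · exact Or.inl fun t ht => Real.exp_le_exp.2 (by nlinarith)
      · exact Or.inr fun t ht => Real.exp_le_exp.2 (by nlinarith)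
  · have h2 := two_lt_cast hd h
    set s : ℝ := ((d : ℝ) - 2) / 2 with hs
    have hs0 : 0 < s := by positivity
    have hG := Real.Gamma_pos_of_pos hs0
    have hint : ∀ r : ℝ, 0 < r →
        ∫ t in Ioi 0, (Real.exp (-(r * t)) - 0) * (t ^ (s - 1) * (1 / (((d : ℝ) - 2) * Real.Gamma s)))
          = radialKernel d r := fun r hr => by
      have := Real.integral_rpow_mul_exp_neg_mul_Ioi hs0 hr
      have h3 : ∀ t : ℝ, (Real.exp (-(r * t)) - 0) *
          (t ^ (s - 1) * (1 / (((d : ℝ) - 2) * Real.Gamma s))) =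
          (t ^ (s - 1) * Real.exp (-(r * t))) * (1 / (((d : ℝ) - 2) * Real.Gamma s)) := fun t => by
        ring
      simp_rw [h3]
      rw [integral_mul_const, this, radialKernel_of_ne_two h, Real.div_rpow zero_le_one hr.le,
        Real.one_rpow]
      have : 0 < r ^ s := Real.rpow_pos_of_pos hr _
      rw [← hs]
      field_simp
    refine ⟨fun t => t ^ (s - 1) * (1 / (((d : ℝ) - 2) * Real.Gamma s)), fun _ => 0,
      by fun_prop, by fun_prop, fun t ht => ?_, fun r hr => ⟨?_, hint r hr, ?_⟩⟩
    · have := Real.rpow_pos_of_pos ht (s - 1)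
      positivity
    · refine not_imp_comm.1 integral_undef ?_
      rw [hint r hr, radialKernel_of_ne_two h]
      have : 0 < r ^ s := Real.rpow_pos_of_pos hr _
      positivity
    · exact Or.inl fun t _ => (Real.exp_pos _).le

lemma integral_add_sub_sub {α E : Type*} [MeasurableSpace α] [NormedAddCommGroup E]
    [NormedSpace ℝ E] {m : Measure α} {f₁ f₂ f₃ f₄ : α → E} (h₁ : Integrable f₁ m)
    (h₂ : Integrable f₂ m) (h₃ : Integrable f₃ m) (h₄ : Integrable f₄ m) :
    (∫ x, f₁ x ∂m) + (∫ x, f₂ x ∂m) - (∫ x, f₃ x ∂m) - ∫ x, f₄ x ∂m =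
      ∫ x, (f₁ x + f₂ x - f₃ x - f₄ x) ∂m := by
  rw [integral_sub (f := fun x => f₁ x + f₂ x - f₃ x) ((h₁.add h₂).sub h₃) h₄,
    integral_sub (f := fun x => f₁ x + f₂ x) (h₁.add h₂) h₃, integral_add h₁ h₂]

/-- The Gaussian interaction of two measures. -/
def gaussianInteraction {d : ℕ} (t : ℝ) (μ ν : Measure (Space d)) : ℝ :=
  ∫ z, Real.exp (-(t * ‖z.1 - z.2‖ ^ 2)) ∂(μ.prod ν)

lemma integrable_gaussian_prod {d : ℕ} {t : ℝ} (ht : 0 ≤ t) (m : Measure (Space d × Space d))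
    [IsFiniteMeasure m] : Integrable (fun z => Real.exp (-(t * ‖z.1 - z.2‖ ^ 2))) m := by
  refine Integrable.of_bound (C := 1) (by fun_prop) (ae_of_all _ fun z => ?_)
  rw [Real.norm_of_nonneg (Real.exp_pos _).le, Real.exp_le_one_iff]
  have := mul_nonneg ht (sq_nonneg ‖z.1 - z.2‖)
  linarith

lemma integral_char_prod {d : ℕ} (μ ν : Measure (Space d)) [IsProbabilityMeasure μ]
    [IsProbabilityMeasure ν] (v : Space d) :
    ∫ z, Complex.exp (Complex.I * (inner ℝ (z.1 - z.2) v : ℝ)) ∂(μ.prod ν) =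
      charFun μ v * conj (charFun ν v) := by
  rw [← charFun_neg, charFun_apply, charFun_apply, ← integral_prod_mul]
  refine integral_congr_ae (ae_of_all _ fun z => ?_)
  simp only
  rw [← Complex.exp_add]
  congr 1
  rw [inner_sub_left, inner_neg_right]
  push_cast
  ring

lemma integrable_gaussian {d : ℕ} {b : ℝ} (hb : 0 < b) :
    Integrable fun v : Space d => Real.exp (-b * ‖v‖ ^ 2) := by
  have := GaussianFourier.integrable_cexp_neg_mul_sq_norm_add (b := (b : ℂ)) (by simpa) 0
    (0 : Space d)
  simp only [zero_mul, add_zero] at this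
  have h2 := this.re
  refine h2.congr (ae_of_all _ fun v => ?_)
  have : (-(b : ℂ) * (‖v‖ : ℂ) ^ 2) = ((-b * ‖v‖ ^ 2 : ℝ) : ℂ) := by push_cast; ring
  simp only [this, ← Complex.ofReal_exp, RCLike.re_to_complex, Complex.ofReal_re]

lemma exp_neg_mul_sq_norm_eq_integral {d : ℕ} {t : ℝ} (ht : 0 < t) :
    ∃ b c : ℝ, 0 < b ∧ 0 < c ∧ ∀ x : Space d, (Real.exp (-(t * ‖x‖ ^ 2)) : ℂ) =
      c * ∫ v : Space d, Real.exp (-b * ‖v‖ ^ 2) * Complex.exp (Complex.I * (inner ℝ x v : ℝ)) := by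
  have hb : 0 < 1 / (4 * t) := by positivity
  refine ⟨1 / (4 * t), (∫ v : Space d, Real.exp (-(1 / (4 * t)) * ‖v‖ ^ 2))⁻¹, hb, ?_, ?_⟩
  · rw [GaussianFourier.integral_rexp_neg_mul_sq_norm hb]
    positivity
  · intro x
    have h1 := GaussianFourier.integral_cexp_neg_mul_sq_norm_add
      (b := ((1 / (4 * t) : ℝ) : ℂ)) (by simpa using hb) Complex.I x
    have h0 := GaussianFourier.integral_cexp_neg_mul_sq_norm (V := Space d)
      (b := ((1 / (4 * t) : ℝ) : ℂ)) (by simpa using hb)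
    have hc : ((∫ v : Space d, Real.exp (-(1 / (4 * t)) * ‖v‖ ^ 2) : ℝ) : ℂ) =
        ∫ v : Space d, Complex.exp (-((1 / (4 * t) : ℝ) : ℂ) * ‖v‖ ^ 2) := by
      rw [← integral_complex_ofReal]
      refine integral_congr_ae (ae_of_all _ fun v => ?_)
      simp only [Complex.ofReal_exp]
      congr 1
      push_cast
      ring
    have hne : (∫ v : Space d, Real.exp (-(1 / (4 * t)) * ‖v‖ ^ 2)) ≠ 0 := by
      rw [GaussianFourier.integral_rexp_neg_mul_sq_norm hb]
      positivity
    have h2 : ∫ v : Space d, (Real.exp (-(1 / (4 * t)) * ‖v‖ ^ 2) : ℂ) *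
        Complex.exp (Complex.I * (inner ℝ x v : ℝ)) =
        ∫ v : Space d, Complex.exp (-((1 / (4 * t) : ℝ) : ℂ) * ‖v‖ ^ 2 +
          Complex.I * (inner ℝ x v : ℝ)) := by
      refine integral_congr_ae (ae_of_all _ fun v => ?_)
      simp only [Complex.ofReal_exp, Complex.exp_add]
      congr 2
      push_cast
      ring
    rw [h2, h1, ← h0, ← hc, Complex.ofReal_inv, inv_mul_cancel_left₀ (by exact_mod_cast hne),
      Complex.ofReal_exp]
    congr 1
    rw [Complex.I_sq]
    push_cast
    have : (t : ℂ) ≠ 0 := by exact_mod_cast ht.ne'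
    field_simp

/-- The Gaussian interaction in Fourier variables. -/
lemma exists_gaussianInteraction_eq {d : ℕ} {t : ℝ} (ht : 0 < t) :
    ∃ b c : ℝ, 0 < b ∧ 0 < c ∧ ∀ (μ ν : Measure (Space d)) [IsProbabilityMeasure μ]
      [IsProbabilityMeasure ν], (gaussianInteraction t μ ν : ℂ) =
        c * ∫ v : Space d, Real.exp (-b * ‖v‖ ^ 2) * (charFun μ v * conj (charFun ν v)) := by
  obtain ⟨b, c, hb, hc, h⟩ := exp_neg_mul_sq_norm_eq_integral (d := d) ht
  refine ⟨b, c, hb, hc, fun μ ν _ _ => ?_⟩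
  rw [gaussianInteraction, ← integral_complex_ofReal]
  simp_rw [h]
  rw [integral_const_mul, integral_integral_swap]
  · congr 1
    refine integral_congr_ae (ae_of_all _ fun v => ?_)
    simp only
    rw [integral_const_mul, integral_char_prod]
  · have h1 : Integrable (fun p : (Space d × Space d) × Space d => Real.exp (-b * ‖p.2‖ ^ 2))
        ((μ.prod ν).prod volume) := (integrable_gaussian hb).comp_snd _
    refine h1.mono (by fun_prop) (ae_of_all _ fun p => ?_)
    simp only [Function.uncurry]
    rw [norm_mul, mul_comm Complex.I, Complex.norm_exp_ofReal_mul_I, mul_one, Complex.norm_real]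

lemma integrable_gaussian_mul_charFun {d : ℕ} {b : ℝ} (hb : 0 < b) (μ ν : Measure (Space d))
    [IsProbabilityMeasure μ] [IsProbabilityMeasure ν] :
    Integrable fun v : Space d =>
      (Real.exp (-b * ‖v‖ ^ 2) : ℂ) * (charFun μ v * conj (charFun ν v)) := by
  refine (integrable_gaussian hb).mono ?_ (ae_of_all _ fun v => ?_)
  · have h1 : Continuous (charFun μ) := continuous_charFun
    have h2 : Continuous (charFun ν) := continuous_charFun
    exact Continuous.aestronglyMeasurable (by fun_prop)
  · rw [norm_mul, Complex.norm_real]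
    refine mul_le_of_le_one_right (norm_nonneg _) ?_
    rw [norm_mul, RCLike.norm_conj]
    exact mul_le_one₀ (norm_charFun_le_one v) (norm_nonneg _) (norm_charFun_le_one v)

/-- The Gaussian kernel is positive definite, strictly on differences of probability measures. -/
lemma gaussianInteraction_add_sub {d : ℕ} {t : ℝ} (ht : 0 < t) (μ ν : Measure (Space d))
    [IsProbabilityMeasure μ] [IsProbabilityMeasure ν] :
    0 ≤ gaussianInteraction t μ μ + gaussianInteraction t ν ν
        - gaussianInteraction t μ ν - gaussianInteraction t ν μ ∧
      (μ ≠ ν → 0 < gaussianInteraction t μ μ + gaussianInteraction t ν ν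
        - gaussianInteraction t μ ν - gaussianInteraction t ν μ) := by
  obtain ⟨b, c, hb, hc, h⟩ := exists_gaussianInteraction_eq (d := d) ht
  set F : Space d → ℝ := fun v =>
    Real.exp (-b * ‖v‖ ^ 2) * ‖charFun μ v - charFun ν v‖ ^ 2 with hF
  have hcont : Continuous F := by
    have h1 : Continuous (charFun μ) := continuous_charFun
    have h2 : Continuous (charFun ν) := continuous_charFun
    fun_prop
  have hFn : 0 ≤ F := fun v => by positivity
  have hFint : Integrable F := by
    refine ((integrable_gaussian hb).mul_const 4).mono' hcont.aestronglyMeasurable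
      (ae_of_all _ fun v => ?_)
    rw [Real.norm_of_nonneg (hFn v)]
    have h3 : ‖charFun μ v - charFun ν v‖ ≤ 2 :=
      (norm_sub_le _ _).trans (by
        have := norm_charFun_le_one (μ := μ) v
        have := norm_charFun_le_one (μ := ν) v
        linarith)
    have h4 := norm_nonneg (charFun μ v - charFun ν v)
    simp only [hF]
    gcongr
    nlinarith
  have key : gaussianInteraction t μ μ + gaussianInteraction t ν ν
        - gaussianInteraction t μ ν - gaussianInteraction t ν μ = c * ∫ v, F v := by
    have : ((gaussianInteraction t μ μ + gaussianInteraction t ν ν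
        - gaussianInteraction t μ ν - gaussianInteraction t ν μ : ℝ) : ℂ)
          = ((c * ∫ v, F v : ℝ) : ℂ) := by
      push_cast
      rw [h μ μ, h ν ν, h μ ν, h ν μ, ← integral_complex_ofReal, ← mul_add, ← mul_sub, ← mul_sub,
        integral_add_sub_sub (integrable_gaussian_mul_charFun hb μ μ)
          (integrable_gaussian_mul_charFun hb ν ν) (integrable_gaussian_mul_charFun hb μ ν)
          (integrable_gaussian_mul_charFun hb ν μ)]
      congr 1
      refine integral_congr_ae (ae_of_all _ fun v => ?_)
      simp only [hF, Complex.ofReal_mul, Complex.ofReal_pow]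
      rw [← Complex.mul_conj', map_sub]
      ring
    exact_mod_cast this
  rw [key]
  refine ⟨mul_nonneg hc.le (integral_nonneg hFn), fun hne => mul_pos hc ?_⟩
  rw [integral_pos_iff_support_of_nonneg hFn hFint]
  have hex : ∃ v, charFun μ v ≠ charFun ν v := by
    by_contra hcon
    push Not at hcon
    exact hne (Measure.ext_of_charFun (funext hcon))
  obtain ⟨v, hv⟩ := hex
  refine hcont.isOpen_support.measure_pos _ ⟨v, ?_⟩
  rw [Function.mem_support]
  have : 0 < ‖charFun μ v - charFun ν v‖ := norm_pos_iff.2 (sub_ne_zero.2 hv)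
  exact ne_of_gt (mul_pos (Real.exp_pos _) (by positivity))

/-- The logarithmic weight compensating the negative part of the Coulomb kernel at infinity. -/
def logWeight {d : ℕ} (x : Space d) : ℝ := Real.log (1 + ‖x‖)

lemma logWeight_nonneg {d : ℕ} (x : Space d) : 0 ≤ logWeight x :=
  Real.log_nonneg (by linarith [norm_nonneg x])

lemma logWeight_le_norm {d : ℕ} (x : Space d) : logWeight x ≤ ‖x‖ := by
  have := Real.log_le_sub_one_of_pos (x := 1 + ‖x‖) (by positivity)
  unfold logWeight
  linarith

lemma continuous_logWeight {d : ℕ} : Continuous (logWeight (d := d)) :=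
  Continuous.log (by fun_prop) fun x => by positivity

lemma neg_logWeight_le_radialKernel {d : ℕ} (hd : 2 ≤ d) (x y : Space d) {ε : ℝ}
    (hε : ε ≤ 1) (hpos : 0 < ‖x - y‖ ^ 2 + ε) :
    -(logWeight x + logWeight y) ≤ radialKernel d (‖x - y‖ ^ 2 + ε) := by
  have hx := norm_nonneg x
  have hy := norm_nonneg y
  have h0 := norm_nonneg (x - y)
  have h1 := norm_sub_le x y
  have h2 : ‖x - y‖ ^ 2 + ε ≤ ((1 + ‖x‖) * (1 + ‖y‖)) ^ 2 := by
    have : ‖x - y‖ ^ 2 ≤ (‖x‖ + ‖y‖) ^ 2 := by gcongr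
    have hxy := mul_nonneg hx hy
    nlinarith [mul_nonneg hxy hx, mul_nonneg hxy hy, mul_nonneg hxy hxy]
  have h3 : 1 ≤ ((1 + ‖x‖) * (1 + ‖y‖)) ^ 2 := by
    have : 1 ≤ (1 + ‖x‖) * (1 + ‖y‖) := by nlinarith
    nlinarith
  refine le_trans (le_of_eq ?_) (neg_half_log_le_radialKernel hd hpos h2 h3)
  rw [Real.log_pow, Real.log_mul (by positivity) (by positivity)]
  simp only [logWeight]
  push_cast
  ring

/-- The regularised Coulomb kernel. -/
def smoothKernel (d : ℕ) (ε : ℝ) (z : Space d × Space d) : ℝ :=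
  radialKernel d (‖z.1 - z.2‖ ^ 2 + ε)

lemma continuous_smoothKernel {d : ℕ} (hd : 2 ≤ d) {ε : ℝ} (hε : 0 < ε) :
    Continuous (smoothKernel d ε) :=
  (continuousOn_radialKernel hd).comp_continuous (by fun_prop) fun z => by
    rw [mem_Ioi]; positivity

lemma abs_smoothKernel_le {d : ℕ} (hd : 2 ≤ d) {ε : ℝ} (hε : 0 < ε) (hε1 : ε ≤ 1)
    (z : Space d × Space d) :
    |smoothKernel d ε z| ≤ |radialKernel d ε| + (logWeight z.1 + logWeight z.2) := by
  have hp : 0 < ‖z.1 - z.2‖ ^ 2 + ε := by positivity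
  have h1 := neg_logWeight_le_radialKernel hd z.1 z.2 hε1 hp
  have h2 : radialKernel d (‖z.1 - z.2‖ ^ 2 + ε) ≤ radialKernel d ε :=
    radialKernel_antitoneOn hd hε hp (by linarith [sq_nonneg ‖z.1 - z.2‖])
  have h3 := logWeight_nonneg z.1
  have h4 := logWeight_nonneg z.2
  have h5 := le_abs_self (radialKernel d ε)
  have h6 := abs_nonneg (radialKernel d ε)
  unfold smoothKernel
  rw [abs_le]
  constructor <;> linarith

lemma integrable_logWeight_prod {d : ℕ} {μ ν : Measure (Space d)} [IsProbabilityMeasure μ]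
    [IsProbabilityMeasure ν] (hμ : Integrable logWeight μ) (hν : Integrable logWeight ν) :
    Integrable (fun z : Space d × Space d => logWeight z.1 + logWeight z.2) (μ.prod ν) :=
  (hμ.comp_fst ν).add (hν.comp_snd μ)

lemma integral_logWeight_prod {d : ℕ} {μ ν : Measure (Space d)} [IsProbabilityMeasure μ]
    [IsProbabilityMeasure ν] (hμ : Integrable logWeight μ) (hν : Integrable logWeight ν) :
    ∫ z : Space d × Space d, (logWeight z.1 + logWeight z.2) ∂(μ.prod ν) =
      ∫ x, logWeight x ∂μ + ∫ x, logWeight x ∂ν := by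
  rw [integral_add (hμ.comp_fst ν) (hν.comp_snd μ), integral_fun_fst, integral_fun_snd]
  simp

lemma integrable_smoothKernel {d : ℕ} (hd : 2 ≤ d) {ε : ℝ} (hε : 0 < ε) (hε1 : ε ≤ 1)
    {μ ν : Measure (Space d)} [IsProbabilityMeasure μ]
    [IsProbabilityMeasure ν] (hμ : Integrable logWeight μ) (hν : Integrable logWeight ν) :
    Integrable (smoothKernel d ε) (μ.prod ν) :=
  ((integrable_const _).add (integrable_logWeight_prod hμ hν)).mono'
    (continuous_smoothKernel hd hε).aestronglyMeasurable
    (ae_of_all _ fun z => abs_smoothKernel_le hd hε hε1 z)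

lemma integral_smoothKernel_symm {d : ℕ} {ε : ℝ} (μ ν : Measure (Space d))
    [IsProbabilityMeasure μ] [IsProbabilityMeasure ν] :
    ∫ z, smoothKernel d ε z ∂(μ.prod ν) = ∫ z, smoothKernel d ε z ∂(ν.prod μ) := by
  rw [← integral_prod_swap]
  refine integral_congr_ae (ae_of_all _ fun z => ?_)
  simp only [smoothKernel, Prod.fst_swap, Prod.snd_swap]
  rw [norm_sub_rev]

lemma integrable_laplace_prod {d : ℕ} (hd : 2 ≤ d) {w e : ℝ → ℝ}
    (hwe : IsLaplaceRepresentation d w e) {ε : ℝ} (hε : 0 < ε) (hε1 : ε ≤ 1)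
    {μ ν : Measure (Space d)} [IsProbabilityMeasure μ] [IsProbabilityMeasure ν]
    (hμ : Integrable logWeight μ) (hν : Integrable logWeight ν) :
    Integrable (fun p : (Space d × Space d) × ℝ =>
      (Real.exp (-((‖p.1.1 - p.1.2‖ ^ 2 + ε) * p.2)) - e p.2) * w p.2)
      ((μ.prod ν).prod (volume.restrict (Ioi 0))) := by
  obtain ⟨hw, he, -, h⟩ := hwe
  have hp : ∀ z : Space d × Space d, 0 < ‖z.1 - z.2‖ ^ 2 + ε := fun z => by positivity
  rw [integrable_prod_iff (Measurable.aestronglyMeasurable (by fun_prop))]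
  refine ⟨ae_of_all _ fun z => (h _ (hp z)).1, ?_⟩
  simp only [Real.norm_eq_abs]
  refine (integrable_smoothKernel hd hε hε1 hμ hν).abs.congr (ae_of_all _ fun z => ?_)
  exact ((h _ (hp z)).2.2).symm

lemma laplace_integrand_eq {d : ℕ} (w e : ℝ → ℝ) (ε : ℝ) (μ ν : Measure (Space d))
    [IsProbabilityMeasure μ] [IsProbabilityMeasure ν] {t : ℝ} (ht : 0 < t) :
    ∫ z : Space d × Space d, (Real.exp (-((‖z.1 - z.2‖ ^ 2 + ε) * t)) - e t) * w t ∂(μ.prod ν) =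
      (Real.exp (-(ε * t)) * gaussianInteraction t μ ν - e t) * w t := by
  rw [integral_mul_const]
  congr 1
  have h1 : ∀ z : Space d × Space d, Real.exp (-((‖z.1 - z.2‖ ^ 2 + ε) * t)) =
      Real.exp (-(ε * t)) * Real.exp (-(t * ‖z.1 - z.2‖ ^ 2)) := fun z => by
    rw [← Real.exp_add]; congr 1; ring
  simp_rw [h1]
  rw [integral_sub ((integrable_gaussian_prod ht.le _).const_mul _) (integrable_const _),
    integral_const_mul, gaussianInteraction]
  simp

lemma integral_smoothKernel_eq {d : ℕ} (hd : 2 ≤ d) {w e : ℝ → ℝ}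
    (hwe : IsLaplaceRepresentation d w e) {ε : ℝ} (hε : 0 < ε) (hε1 : ε ≤ 1)
    {μ ν : Measure (Space d)} [IsProbabilityMeasure μ] [IsProbabilityMeasure ν]
    (hμ : Integrable logWeight μ) (hν : Integrable logWeight ν) :
    ∫ z, smoothKernel d ε z ∂(μ.prod ν) =
      ∫ t in Ioi 0, (Real.exp (-(ε * t)) * gaussianInteraction t μ ν - e t) * w t := by
  have hp : ∀ z : Space d × Space d, 0 < ‖z.1 - z.2‖ ^ 2 + ε := fun z => by positivity
  have h1 : ∀ z : Space d × Space d, smoothKernel d ε z =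
      ∫ t in Ioi 0, (Real.exp (-((‖z.1 - z.2‖ ^ 2 + ε) * t)) - e t) * w t := fun z =>
    ((hwe.2.2.2 _ (hp z)).2.1).symm
  simp_rw [h1]
  rw [integral_integral_swap (integrable_laplace_prod hd hwe hε hε1 hμ hν)]
  exact setIntegral_congr_fun measurableSet_Ioi fun t ht =>
    laplace_integrand_eq w e ε μ ν ht

lemma integrableOn_laplace_integrand {d : ℕ} (hd : 2 ≤ d) {w e : ℝ → ℝ}
    (hwe : IsLaplaceRepresentation d w e) {ε : ℝ} (hε : 0 < ε) (hε1 : ε ≤ 1)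
    {μ ν : Measure (Space d)} [IsProbabilityMeasure μ] [IsProbabilityMeasure ν]
    (hμ : Integrable logWeight μ) (hν : Integrable logWeight ν) :
    IntegrableOn (fun t => (Real.exp (-(ε * t)) * gaussianInteraction t μ ν - e t) * w t)
      (Ioi 0) := by
  have := (integrable_laplace_prod hd hwe hε hε1 hμ hν).integral_prod_right
  refine Integrable.congr this ?_
  exact (ae_restrict_iff' measurableSet_Ioi).2 (ae_of_all _ fun t ht =>
    laplace_integrand_eq w e ε μ ν ht)

/-- The interaction energy of `μ - ν` for the regularised kernel. -/
def smoothEnergyDiff {d : ℕ} (ε : ℝ) (μ ν : Measure (Space d)) : ℝ :=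
  (∫ z, smoothKernel d ε z ∂(μ.prod μ)) + (∫ z, smoothKernel d ε z ∂(ν.prod ν))
    - 2 * ∫ z, smoothKernel d ε z ∂(μ.prod ν)

lemma smoothEnergyDiff_pos {d : ℕ} (hd : 2 ≤ d) {μ ν : Measure (Space d)}
    [IsProbabilityMeasure μ] [IsProbabilityMeasure ν] (hμ : Integrable logWeight μ)
    (hν : Integrable logWeight ν) :
    0 ≤ smoothEnergyDiff 1 μ ν ∧ (μ ≠ ν → 0 < smoothEnergyDiff 1 μ ν) ∧
      ∀ ε, 0 < ε → ε ≤ 1 → smoothEnergyDiff 1 μ ν ≤ smoothEnergyDiff ε μ ν := by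
  obtain ⟨w, e, hwe⟩ := exists_laplace_representation hd
  have hwpos := hwe.2.2.1
  set Q : ℝ → ℝ := fun t => gaussianInteraction t μ μ + gaussianInteraction t ν ν
        - gaussianInteraction t μ ν - gaussianInteraction t ν μ with hQ
  have key : ∀ ε, 0 < ε → ε ≤ 1 →
      smoothEnergyDiff ε μ ν = ∫ t in Ioi 0, Real.exp (-(ε * t)) * Q t * w t ∧
        IntegrableOn (fun t => Real.exp (-(ε * t)) * Q t * w t) (Ioi 0) := by
    intro ε hε hε1
    have i1 := integrableOn_laplace_integrand hd hwe hε hε1 hμ hμ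
    have i2 := integrableOn_laplace_integrand hd hwe hε hε1 hν hν
    have i3 := integrableOn_laplace_integrand hd hwe hε hε1 hμ hν
    have i4 := integrableOn_laplace_integrand hd hwe hε hε1 hν hμ
    have heq : (fun t => (Real.exp (-(ε * t)) * gaussianInteraction t μ μ - e t) * w t
        + (Real.exp (-(ε * t)) * gaussianInteraction t ν ν - e t) * w t
        - (Real.exp (-(ε * t)) * gaussianInteraction t μ ν - e t) * w t
        - (Real.exp (-(ε * t)) * gaussianInteraction t ν μ - e t) * w t)
        = fun t => Real.exp (-(ε * t)) * Q t * w t := by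
      funext t
      simp only [hQ]
      ring
    constructor
    · rw [← heq, ← integral_add_sub_sub i1 i2 i3 i4,
        ← integral_smoothKernel_eq hd hwe hε hε1 hμ hμ,
        ← integral_smoothKernel_eq hd hwe hε hε1 hν hν,
        ← integral_smoothKernel_eq hd hwe hε hε1 hμ hν,
        ← integral_smoothKernel_eq hd hwe hε hε1 hν hμ, integral_smoothKernel_symm ν μ,
        smoothEnergyDiff]
      ring
    · rw [← heq]
      exact ((i1.add i2).sub i3).sub i4
  have hQ0 : ∀ t, 0 < t → 0 ≤ Q t := fun t ht => (gaussianInteraction_add_sub ht μ ν).1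
  obtain ⟨k1, k2⟩ := key 1 one_pos le_rfl
  have hnn : ∀ t ∈ Ioi (0 : ℝ), 0 ≤ Real.exp (-(1 * t)) * Q t * w t := fun t ht =>
    mul_nonneg (mul_nonneg (Real.exp_pos _).le (hQ0 t ht)) (hwpos t ht).le
  refine ⟨?_, fun hne => ?_, fun ε hε hε1 => ?_⟩
  · rw [k1]
    exact setIntegral_nonneg measurableSet_Ioi hnn
  · rw [k1, setIntegral_pos_iff_support_of_nonneg_ae
      ((ae_restrict_iff' measurableSet_Ioi).2 (ae_of_all _ hnn)) k2]
    have : Function.support (fun t => Real.exp (-(1 * t)) * Q t * w t) ∩ Ioi 0 = Ioi 0 := by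
      refine inter_eq_right.2 fun t ht => ?_
      exact (mul_pos (mul_pos (Real.exp_pos _) ((gaussianInteraction_add_sub ht μ ν).2 hne))
        (hwpos t ht)).ne'
    rw [this, Real.volume_Ioi]
    exact ENNReal.zero_lt_top
  · obtain ⟨l1, l2⟩ := key ε hε hε1
    rw [k1, l1]
    refine setIntegral_mono_on k2 l2 measurableSet_Ioi fun t ht => ?_
    have := hQ0 t ht
    have := (hwpos t ht).le
    have ht' : 0 < t := ht
    gcongr

/-- The regularised Coulomb kernel made nonnegative by the logarithmic weights. -/
def regKernel (d : ℕ) (n : ℕ) (z : Space d × Space d) : ℝ :=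
  smoothKernel d (1 / ((n : ℝ) + 1)) z + (logWeight z.1 + logWeight z.2)

/-- The Coulomb kernel made nonnegative by the logarithmic weights. -/
def posKernel (d : ℕ) (z : Space d × Space d) : ℝ≥0∞ := ⨆ n, ENNReal.ofReal (regKernel d n z)

lemma one_div_succ_pos (n : ℕ) : (0 : ℝ) < 1 / ((n : ℝ) + 1) := by positivity

lemma one_div_succ_le_one (n : ℕ) : 1 / ((n : ℝ) + 1) ≤ 1 := by
  rw [div_le_one (by positivity)]
  have : (0 : ℝ) ≤ n := n.cast_nonneg
  linarith

lemma regKernel_nonneg {d : ℕ} (hd : 2 ≤ d) (n : ℕ) (z : Space d × Space d) :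
    0 ≤ regKernel d n z := by
  have hp : 0 < ‖z.1 - z.2‖ ^ 2 + 1 / ((n : ℝ) + 1) := by positivity
  have := neg_logWeight_le_radialKernel hd z.1 z.2 (one_div_succ_le_one n) hp
  unfold regKernel smoothKernel
  linarith

lemma continuous_regKernel {d : ℕ} (hd : 2 ≤ d) (n : ℕ) : Continuous (regKernel d n) :=
  (continuous_smoothKernel hd (one_div_succ_pos n)).add
    ((continuous_logWeight.comp continuous_fst).add (continuous_logWeight.comp continuous_snd))

lemma regKernel_mono {d : ℕ} (hd : 2 ≤ d) (z : Space d × Space d) :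
    Monotone fun n => regKernel d n z := by
  intro n m hnm
  simp only [regKernel, smoothKernel]
  have h1 : 1 / ((m : ℝ) + 1) ≤ 1 / ((n : ℝ) + 1) := Nat.one_div_le_one_div hnm
  have h2 : 0 < ‖z.1 - z.2‖ ^ 2 + 1 / ((m : ℝ) + 1) := by positivity
  have h3 : 0 < ‖z.1 - z.2‖ ^ 2 + 1 / ((n : ℝ) + 1) := by positivity
  have := radialKernel_antitoneOn hd h2 h3 (by linarith)
  linarith

lemma posKernel_swap {d : ℕ} (z : Space d × Space d) : posKernel d z.swap = posKernel d z := by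
  simp only [posKernel, regKernel, smoothKernel, Prod.fst_swap, Prod.snd_swap]
  rw [norm_sub_rev, add_comm (logWeight z.2)]

lemma lowerSemicontinuous_posKernel {d : ℕ} (hd : 2 ≤ d) : LowerSemicontinuous (posKernel d) :=
  lowerSemicontinuous_iSup fun n =>
    (ENNReal.continuous_ofReal.comp (continuous_regKernel hd n)).lowerSemicontinuous

lemma measurable_posKernel {d : ℕ} (hd : 2 ≤ d) : Measurable (posKernel d) :=
  (lowerSemicontinuous_posKernel hd).measurable

lemma tendsto_one_div_succ_nhdsGT (r : ℝ) :
    Tendsto (fun n : ℕ => r + 1 / ((n : ℝ) + 1)) atTop (𝓝[>] r) := by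
  refine tendsto_nhdsWithin_iff.2 ⟨?_, Eventually.of_forall fun n => ?_⟩
  · simpa using tendsto_one_div_add_atTop_nhds_zero_nat.const_add r
  · have := one_div_succ_pos n
    rw [mem_Ioi]
    linarith

lemma kernel_add_logWeight {d : ℕ} (hd : 2 ≤ d) (x y : Space d) :
    kernel d (x - y) + ((logWeight x + logWeight y : ℝ) : EReal) = (posKernel d (x, y) : EReal) := by
  have hmono : Monotone fun n => ENNReal.ofReal (regKernel d n (x, y)) := fun n m hnm =>
    ENNReal.ofReal_le_ofReal (regKernel_mono hd (x, y) hnm)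
  have htend := tendsto_atTop_iSup hmono
  by_cases hxy : x = y
  · subst hxy
    have h1 : Tendsto (fun n => regKernel d n (x, x)) atTop atTop := by
      refine tendsto_atTop_add_const_right _ _ ?_
      have := (tendsto_radialKernel_zero hd).comp (tendsto_one_div_succ_nhdsGT 0)
      simpa [smoothKernel, Function.comp_def] using this
    have h2 := tendsto_nhds_unique htend (ENNReal.tendsto_ofReal_atTop.comp h1)
    rw [posKernel, h2]
    simp [kernel]
  · have hne : x - y ≠ 0 := sub_ne_zero.2 hxy
    have hp : 0 < ‖x - y‖ ^ 2 := by have := norm_pos_iff.2 hne; positivity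
    have h1 : Tendsto (fun n => regKernel d n (x, y)) atTop
        (𝓝 (radialKernel d (‖x - y‖ ^ 2) + (logWeight x + logWeight y))) := by
      refine Tendsto.add_const _ ?_
      exact ((continuousOn_radialKernel hd).continuousAt (Ioi_mem_nhds hp)).tendsto.comp
        ((tendsto_one_div_succ_nhdsGT (‖x - y‖ ^ 2)).mono_right nhdsWithin_le_nhds)
    have h2 := tendsto_nhds_unique htend ((ENNReal.continuous_ofReal.tendsto _).comp h1)
    have h3 := neg_logWeight_le_radialKernel hd x y zero_le_one (by simpa using hp)
    rw [add_zero] at h3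
    rw [posKernel, h2, kernel_eq_radialKernel hd hne, EReal.coe_ennreal_ofReal,
      max_eq_left (by linarith)]
    rfl

/-- The mutual energy of two measures for the compensated kernel. -/
def mutualEnergy {d : ℕ} (μ ν : Measure (Space d)) : ℝ≥0∞ := ∫⁻ z, posKernel d z ∂(μ.prod ν)

lemma mutualEnergy_comm {d : ℕ} (μ ν : Measure (Space d)) [SFinite μ] [SFinite ν] :
    mutualEnergy μ ν = mutualEnergy ν μ := by
  rw [mutualEnergy, mutualEnergy, ← lintegral_prod_swap]
  exact lintegral_congr fun z => posKernel_swap z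

lemma mutualEnergy_eq_iSup {d : ℕ} (hd : 2 ≤ d) (μ ν : Measure (Space d)) :
    mutualEnergy μ ν = ⨆ n, ∫⁻ z, ENNReal.ofReal (regKernel d n z) ∂(μ.prod ν) :=
  lintegral_iSup
    (fun n => (ENNReal.continuous_ofReal.comp (continuous_regKernel hd n)).measurable)
    fun _ _ hnm z => ENNReal.ofReal_le_ofReal (regKernel_mono hd z hnm)

lemma lintegral_regKernel {d : ℕ} (hd : 2 ≤ d) (n : ℕ) {μ ν : Measure (Space d)}
    [IsProbabilityMeasure μ] [IsProbabilityMeasure ν] (hμ : Integrable logWeight μ)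
    (hν : Integrable logWeight ν) :
    ∃ A : ℝ, 0 ≤ A ∧ ∫⁻ z, ENNReal.ofReal (regKernel d n z) ∂(μ.prod ν) = ENNReal.ofReal A ∧
      A = (∫ z, smoothKernel d (1 / ((n : ℝ) + 1)) z ∂(μ.prod ν)) +
        (∫ x, logWeight x ∂μ + ∫ x, logWeight x ∂ν) := by
  have h1 := integrable_smoothKernel hd (one_div_succ_pos n) (one_div_succ_le_one n) hμ hν
  have h2 := integrable_logWeight_prod hμ hν
  refine ⟨∫ z, regKernel d n z ∂(μ.prod ν), integral_nonneg (regKernel_nonneg hd n), ?_, ?_⟩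
  · exact (ofReal_integral_eq_lintegral_ofReal (h1.add h2)
      (ae_of_all _ (regKernel_nonneg hd n))).symm
  · rw [← integral_logWeight_prod hμ hν, ← integral_add h1 h2]
    rfl

/-- Strict positivity of the Coulomb energy of the difference of two probability measures. -/
lemma two_mul_mutualEnergy_add_le {d : ℕ} (hd : 2 ≤ d) {μ ν : Measure (Space d)}
    [IsProbabilityMeasure μ] [IsProbabilityMeasure ν] (hμ : Integrable logWeight μ)
    (hν : Integrable logWeight ν) :
    ∃ D : ℝ≥0∞, (μ ≠ ν → 0 < D) ∧ 2 * mutualEnergy μ ν + D ≤ mutualEnergy μ μ + mutualEnergy ν ν := by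
  obtain ⟨h1, h2, h3⟩ := smoothEnergyDiff_pos hd hμ hν
  refine ⟨ENNReal.ofReal (smoothEnergyDiff 1 μ ν), fun hne => ENNReal.ofReal_pos.2 (h2 hne), ?_⟩
  rw [mutualEnergy_eq_iSup hd μ ν, ENNReal.mul_iSup, ENNReal.iSup_add]
  refine iSup_le fun n => ?_
  have hle : ∀ m : Measure (Space d), ∫⁻ z, ENNReal.ofReal (regKernel d n z) ∂(m.prod m) ≤
      mutualEnergy m m := fun m => by
    rw [mutualEnergy_eq_iSup hd]
    exact le_iSup (fun n => ∫⁻ z, ENNReal.ofReal (regKernel d n z) ∂(m.prod m)) n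
  refine le_trans ?_ (add_le_add (hle μ) (hle ν))
  obtain ⟨A, hA, hA1, hA2⟩ := lintegral_regKernel hd n hμ hν
  obtain ⟨B, hB, hB1, hB2⟩ := lintegral_regKernel hd n hμ hμ
  obtain ⟨C, hC, hC1, hC2⟩ := lintegral_regKernel hd n hν hν
  rw [hA1, hB1, hC1, ← ENNReal.ofReal_add hB hC,
    show (2 : ℝ≥0∞) = ENNReal.ofReal 2 by simp, ← ENNReal.ofReal_mul zero_le_two,
    ← ENNReal.ofReal_add (by positivity) h1]
  refine ENNReal.ofReal_le_ofReal ?_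
  have h4 := h3 _ (one_div_succ_pos n) (one_div_succ_le_one n)
  have h5 : smoothEnergyDiff (1 / ((n : ℝ) + 1)) μ ν = B + C - 2 * A := by
    rw [hA2, hB2, hC2, smoothEnergyDiff]
    ring
  linarith

lemma ereal_sub_eq_of_add_eq {A B C F : ℝ≥0∞} (hB : B ≠ ⊤) (hC : C ≠ ⊤) (h : A + C = F + B) :
    (A : EReal) - (B : EReal) = (F : EReal) - ((C.toReal : ℝ) : EReal) := by
  lift B to ℝ≥0 using hB
  lift C to ℝ≥0 using hC
  by_cases hF : F = ⊤
  · subst hF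
    have hA : A = ⊤ := by
      by_contra hA
      simp [hA] at h
    subst hA
    rfl
  · have hA : A ≠ ⊤ := by
      rintro rfl
      simp at h
      exact ENNReal.add_ne_top.2 ⟨hF, ENNReal.coe_ne_top⟩ h.symm
    lift A to ℝ≥0 using hA
    lift F to ℝ≥0 using hF
    have h' : (A : ℝ) + C = F + B := by exact_mod_cast h
    have h2 : (A : ℝ) - B = F - C := by linarith
    exact congrArg (fun r : ℝ => (r : EReal)) h2

lemma toENNReal_add_ofReal_eq {f : EReal} {F : ℝ≥0∞} {c : ℝ} (hc : 0 ≤ c)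
    (h : f + (c : EReal) = F) :
    f.toENNReal + ENNReal.ofReal c = F + (-f).toENNReal ∧
      (-f).toENNReal ≤ ENNReal.ofReal c := by
  induction f with
  | bot =>
    rw [EReal.bot_add] at h
    exact absurd h.symm (EReal.coe_ennreal_ne_bot F)
  | top =>
    have : F = ⊤ := by
      have h' : (⊤ : EReal) = F := by rw [← h]; rfl
      exact EReal.coe_ennreal_eq_top_iff.1 h'.symm
    subst this
    simp
  | coe f =>
    have hF : F ≠ ⊤ := by
      rintro rfl
      exact (EReal.coe_ne_top (f + c)) (by rw [EReal.coe_add, h]; rfl)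
    lift F to ℝ≥0 using hF
    have h' : f + c = F := EReal.coe_eq_coe_iff.1 (by rw [EReal.coe_add, h]; rfl)
    rw [← EReal.coe_neg, EReal.real_coe_toENNReal, EReal.real_coe_toENNReal,
      show ((F : ℝ≥0) : ℝ≥0∞) = ENNReal.ofReal (F : ℝ) by simp, ← h']
    have h0 : 0 ≤ f + c := by rw [h']; exact F.2
    refine ⟨?_, ENNReal.ofReal_le_ofReal (by linarith)⟩
    rcases le_total 0 f with hf | hf
    · rw [ENNReal.ofReal_of_nonpos (p := -f) (by linarith), add_zero, ENNReal.ofReal_add hf hc]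
    · rw [ENNReal.ofReal_of_nonpos (p := f) hf, zero_add,
        ← ENNReal.ofReal_add h0 (by linarith)]
      congr 1
      ring

lemma extIntegral_eq_sub {Ω : Type*} [MeasurableSpace Ω] {m : Measure Ω} {f : Ω → EReal}
    {F : Ω → ℝ≥0∞} {c : Ω → ℝ} (hF : Measurable F) (hcm : Measurable c) (hc0 : ∀ z, 0 ≤ c z)
    (hc : Integrable c m) (h : ∀ z, f z + (c z : EReal) = F z) :
    extIntegral m f = ((∫⁻ z, F z ∂m : ℝ≥0∞) : EReal) - ((∫ z, c z ∂m : ℝ) : EReal) := by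
  have hfin : ∫⁻ z, ENNReal.ofReal (c z) ∂m ≠ ⊤ := by
    rw [← ofReal_integral_eq_lintegral_ofReal hc (ae_of_all _ hc0)]
    exact ENNReal.ofReal_ne_top
  have hint : ∫ z, c z ∂m = (∫⁻ z, ENNReal.ofReal (c z) ∂m).toReal := by
    rw [← ofReal_integral_eq_lintegral_ofReal hc (ae_of_all _ hc0),
      ENNReal.toReal_ofReal (integral_nonneg hc0)]
  rw [extIntegral, hint]
  refine ereal_sub_eq_of_add_eq ?_ hfin ?_
  · exact ne_top_of_le_ne_top hfin
      (lintegral_mono fun z => (toENNReal_add_ofReal_eq (hc0 z) (h z)).2)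
  · rw [← lintegral_add_right _ hcm.ennreal_ofReal, ← lintegral_add_left hF]
    exact lintegral_congr fun z => (toENNReal_add_ofReal_eq (hc0 z) (h z)).1

/-- The external potential made nonnegative after compensation of the logarithmic weights. -/
def shiftedPotential {d : ℕ} (V : Space d → ℝ) (M : ℝ) (x : Space d) : ℝ≥0∞ :=
  ENNReal.ofReal (V x - 2 * logWeight x + M)

/-- The electrostatic energy shifted by the constant `M`, as an extended nonnegative number. -/
def shiftedEnergy {d : ℕ} (V : Space d → ℝ) (M : ℝ) (μ : Measure (Space d)) : ℝ≥0∞ :=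
  mutualEnergy μ μ + ∫⁻ x, shiftedPotential V M x ∂μ

/-- Lower semicontinuous potentials growing at infinity like the `q`-th power of the norm, in a
normalised form. -/
structure Confining {d : ℕ} (V : Space d → ℝ) (q b M : ℝ) : Prop where
  lsc : LowerSemicontinuous V
  one_lt : 1 < q
  pos : 0 < b
  nonneg : 0 ≤ M
  le : ∀ x, b * ‖x‖ ^ q ≤ V x - 2 * logWeight x + M

lemma exists_le_mul_rpow_add {q : ℝ} (hq : 1 < q) {δ : ℝ} (hδ : 0 < δ) :
    ∃ C : ℝ, 0 ≤ C ∧ ∀ r : ℝ, 0 ≤ r → r ≤ δ * r ^ q + C := by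
  refine ⟨(1 / δ) ^ (1 / (q - 1)), by positivity, fun r hr => ?_⟩
  have hq' : 0 < q - 1 := by linarith
  rcases le_total r ((1 / δ) ^ (1 / (q - 1))) with h | h
  · have : 0 ≤ δ * r ^ q := by positivity
    linarith
  · have hr0 : 0 < r := lt_of_lt_of_le (by positivity) h
    have h1 : 1 / δ ≤ r ^ (q - 1) := by
      have := Real.rpow_le_rpow (by positivity) h hq'.le
      rwa [← Real.rpow_mul (by positivity), one_div_mul_cancel hq'.ne', Real.rpow_one] at this
    have h2 : r ^ q = r ^ (q - 1) * r := by
      rw [Real.rpow_sub_one hr0.ne', div_mul_cancel₀ _ hr0.ne']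
    have h3 : 1 ≤ δ * r ^ (q - 1) := by
      rw [div_le_iff₀ hδ] at h1
      linarith
    have h4 : 0 ≤ (1 / δ) ^ (1 / (q - 1)) := by positivity
    rw [h2]
    nlinarith

lemma exists_confining {d : ℕ} {V : Space d → ℝ} (hV : LowerSemicontinuous V) {a R q : ℝ}
    (ha : 0 < a) (hq : 1 < q) (hgrowth : ∀ x, a * ‖x‖ ^ q - R ≤ V x) :
    ∃ M, Confining V q (a / 2) M := by
  obtain ⟨C, hC, h⟩ := exists_le_mul_rpow_add hq (δ := a / 4) (by positivity)
  refine ⟨|R| + 2 * C, hV, hq, by positivity, by positivity, fun x => ?_⟩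
  have h1 := h ‖x‖ (norm_nonneg x)
  have h2 := logWeight_le_norm x
  have h3 := hgrowth x
  have h4 := le_abs_self R
  linarith

lemma exists_growth_add_lipschitz {d : ℕ} {V : Space d → ℝ} {a R q : ℝ}
    (ha : 0 < a) (hq : 1 < q) (hgrowth : ∀ x, a * ‖x‖ ^ q - R ≤ V x)
    {φ : Space d → ℝ} {L : ℝ≥0} (hφ : LipschitzWith L φ) {α : ℝ} (hα : 0 ≤ α) :
    ∃ R', ∀ x, a / 2 * ‖x‖ ^ q - R' ≤ V x + α * φ x := by
  obtain ⟨C, hC, h⟩ := exists_le_mul_rpow_add hq (δ := a / 2 / (α * L + 1)) (by positivity)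
  refine ⟨R + α * |φ 0| + (α * L + 1) * C, fun x => ?_⟩
  have h1 := h ‖x‖ (norm_nonneg x)
  have h2 : |φ x - φ 0| ≤ L * ‖x‖ := by
    have := hφ.dist_le_mul x 0
    rwa [Real.dist_eq, dist_zero_right] at this
  have h3 := hgrowth x
  have h4 : α * (-|φ 0| - L * ‖x‖) ≤ α * φ x := by
    refine mul_le_mul_of_nonneg_left ?_ hα
    have := neg_abs_le (φ 0)
    have := neg_abs_le (φ x - φ 0)
    linarith
  have h5 : (α * L + 1) * ‖x‖ ≤ (α * L + 1) * (a / 2 / (α * L + 1) * ‖x‖ ^ q + C) := by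
    gcongr
  have h6 : (α * L + 1) * (a / 2 / (α * L + 1) * ‖x‖ ^ q + C) =
      a / 2 * ‖x‖ ^ q + (α * L + 1) * C := by
    have : α * L + 1 ≠ 0 := by positivity
    field_simp
  have h7 := norm_nonneg x
  nlinarith

section Confining

variable {d : ℕ} {V : Space d → ℝ} {q b M : ℝ}

lemma Confining.nonneg_shift (hV : Confining V q b M) (x : Space d) :
    0 ≤ V x - 2 * logWeight x + M := by
  have := hV.pos
  exact le_trans (by positivity) (hV.le x)

lemma Confining.lowerSemicontinuous_shiftedPotential (hV : Confining V q b M) :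
    LowerSemicontinuous (shiftedPotential V M) := by
  refine ENNReal.continuous_ofReal.comp_lowerSemicontinuous ?_ ENNReal.ofReal_mono
  have : Continuous fun x : Space d => -(2 * logWeight x) + M := by
    have := continuous_logWeight (d := d)
    fun_prop
  have h := hV.lsc.add this.lowerSemicontinuous
  have h' : (fun x => V x - 2 * logWeight x + M) = fun x => V x + (-(2 * logWeight x) + M) := by
    funext x
    ring
  rw [h']
  exact h

lemma Confining.measurable_shiftedPotential (hV : Confining V q b M) :
    Measurable (shiftedPotential V M) :=
  hV.lowerSemicontinuous_shiftedPotential.measurable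

lemma Confining.rpow_norm_le (hV : Confining V q b M) (x : Space d) :
    ENNReal.ofReal (‖x‖ ^ q) ≤ ENNReal.ofReal b⁻¹ * shiftedPotential V M x := by
  have hb := hV.pos
  rw [shiftedPotential, ← ENNReal.ofReal_mul (by positivity)]
  refine ENNReal.ofReal_le_ofReal ?_
  rw [← div_eq_inv_mul, le_div_iff₀ hb, mul_comm]
  exact hV.le x

lemma Confining.lintegral_rpow_norm_le (hV : Confining V q b M) (μ : Measure (Space d)) :
    ∫⁻ x, ENNReal.ofReal (‖x‖ ^ q) ∂μ ≤ ENNReal.ofReal b⁻¹ * shiftedEnergy V M μ := by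
  refine (lintegral_mono hV.rpow_norm_le).trans ?_
  rw [lintegral_const_mul _ hV.measurable_shiftedPotential]
  exact mul_le_mul_right le_add_self _

lemma Confining.integrable_rpow_norm (hV : Confining V q b M) {μ : Measure (Space d)}
    (h : ∫⁻ x, shiftedPotential V M x ∂μ ≠ ⊤) : Integrable (fun x => ‖x‖ ^ q) μ := by
  refine ⟨Measurable.aestronglyMeasurable (by fun_prop), ?_⟩
  rw [hasFiniteIntegral_iff_ofReal (ae_of_all _ fun x => by positivity)]
  refine (lintegral_mono hV.rpow_norm_le).trans_lt ?_
  rw [lintegral_const_mul _ hV.measurable_shiftedPotential]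
  exact ENNReal.mul_lt_top ENNReal.ofReal_lt_top h.lt_top

lemma Confining.integrable_norm (hV : Confining V q b M) {μ : Measure (Space d)}
    [IsFiniteMeasure μ] (h : ∫⁻ x, shiftedPotential V M x ∂μ ≠ ⊤) :
    Integrable (fun x => ‖x‖) μ := by
  obtain ⟨C, hC, h1⟩ := exists_le_mul_rpow_add hV.one_lt one_pos
  refine (((hV.integrable_rpow_norm h).const_mul 1).add (integrable_const C)).mono'
    (by fun_prop) (ae_of_all _ fun x => ?_)
  rw [norm_norm]
  exact h1 _ (norm_nonneg x)

lemma Confining.integrable_logWeight (hV : Confining V q b M) {μ : Measure (Space d)}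
    [IsFiniteMeasure μ] (h : ∫⁻ x, shiftedPotential V M x ∂μ ≠ ⊤) :
    Integrable logWeight μ := by
  refine (hV.integrable_norm h).mono' continuous_logWeight.aestronglyMeasurable
    (ae_of_all _ fun x => ?_)
  rw [Real.norm_of_nonneg (logWeight_nonneg x)]
  exact logWeight_le_norm x

lemma integrable_lipschitz {φ : Space d → ℝ} {L : ℝ≥0} (hφ : LipschitzWith L φ)
    {μ : Measure (Space d)} [IsFiniteMeasure μ] (h : Integrable (fun x => ‖x‖) μ) :
    Integrable φ μ := by
  refine ((integrable_const |φ 0|).add (h.const_mul (L : ℝ))).mono'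
    hφ.continuous.aestronglyMeasurable (ae_of_all _ fun x => ?_)
  have := hφ.dist_le_mul x 0
  rw [Real.dist_eq, dist_zero_right] at this
  rw [Real.norm_eq_abs, Pi.add_apply]
  have h2 := abs_add_le (φ x - φ 0) (φ 0)
  rw [sub_add_cancel] at h2
  linarith

/-- The energy is the shifted energy minus the shift. -/
lemma Confining.energy_eq (hV : Confining V q b M) (hd : 2 ≤ d)
    (μ : ProbabilityMeasure (Space d)) :
    energy V μ = (shiftedEnergy V M (μ : Measure (Space d)) : EReal) - (M : EReal) := by
  have hmeas : Measurable fun z : Space d × Space d =>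
      (2⁻¹ : ℝ≥0∞) * (shiftedPotential V M z.1 + shiftedPotential V M z.2) := by
    have := hV.measurable_shiftedPotential
    fun_prop
  have h := extIntegral_eq_sub (m := (μ : Measure (Space d)).prod (μ : Measure (Space d)))
    (f := fun z => kernel d (z.1 - z.2) + (((V z.1 + V z.2) / 2 : ℝ) : EReal))
    (F := fun z => posKernel d z + 2⁻¹ * (shiftedPotential V M z.1 + shiftedPotential V M z.2))
    (c := fun _ => M) ((measurable_posKernel hd).add hmeas) measurable_const
    (fun _ => hV.nonneg) (integrable_const _) ?_
  · rw [energy, h, integral_const, shiftedEnergy, mutualEnergy,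
      lintegral_add_left (measurable_posKernel hd)]
    have h1 : ∫⁻ z : Space d × Space d,
        2⁻¹ * (shiftedPotential V M z.1 + shiftedPotential V M z.2)
          ∂((μ : Measure (Space d)).prod (μ : Measure (Space d))) =
        ∫⁻ x, shiftedPotential V M x ∂(μ : Measure (Space d)) := by
      have hm := hV.measurable_shiftedPotential
      rw [lintegral_const_mul _ (by fun_prop), lintegral_add_left (by fun_prop),
        (measurePreserving_fst (μ := (μ : Measure (Space d)))
          (ν := (μ : Measure (Space d)))).lintegral_comp hm,
        (measurePreserving_snd (μ := (μ : Measure (Space d)))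
          (ν := (μ : Measure (Space d)))).lintegral_comp hm, ← two_mul, ← mul_assoc,
        ENNReal.inv_mul_cancel two_ne_zero ENNReal.ofNat_ne_top, one_mul]
    rw [h1]
    simp
  · intro z
    have h1 := hV.nonneg_shift z.1
    have h2 := hV.nonneg_shift z.2
    have h3 : (2⁻¹ : ℝ≥0∞) * (shiftedPotential V M z.1 + shiftedPotential V M z.2) =
        ENNReal.ofReal ((V z.1 + V z.2) / 2 - (logWeight z.1 + logWeight z.2) + M) := by
      rw [shiftedPotential, shiftedPotential, ← ENNReal.ofReal_add h1 h2,
        show (2⁻¹ : ℝ≥0∞) = ENNReal.ofReal (2⁻¹) by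
          rw [ENNReal.ofReal_inv_of_pos two_pos]; simp,
        ← ENNReal.ofReal_mul (by norm_num)]
      congr 1
      ring
    rw [h3, EReal.coe_ennreal_add, EReal.coe_ennreal_ofReal, max_eq_left (by linarith),
      ← kernel_add_logWeight hd, add_assoc, add_assoc, ← EReal.coe_add, ← EReal.coe_add]
    congr 2
    ring

lemma potential_eq (hd : 2 ≤ d) {μ : ProbabilityMeasure (Space d)}
    (hμ : Integrable logWeight (μ : Measure (Space d))) (x : Space d) :
    potential μ x = ((∫⁻ y, posKernel d (x, y) ∂(μ : Measure (Space d)) : ℝ≥0∞) : EReal) -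
      ((logWeight x + ∫ y, logWeight y ∂(μ : Measure (Space d)) : ℝ) : EReal) := by
  have h := extIntegral_eq_sub (m := (μ : Measure (Space d)))
    (f := fun y => kernel d (x - y)) (F := fun y => posKernel d (x, y))
    (c := fun y => logWeight x + logWeight y)
    ((measurable_posKernel hd).comp (by fun_prop))
    (continuous_const.add continuous_logWeight).measurable
    (fun y => add_nonneg (logWeight_nonneg x) (logWeight_nonneg y))
    ((integrable_const _).add hμ) (fun y => kernel_add_logWeight hd x y)
  rw [potential, h, integral_add (integrable_const _) hμ]
  simp

lemma interaction_eq (hd : 2 ≤ d) {μ : ProbabilityMeasure (Space d)}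
    (hμ : Integrable logWeight (μ : Measure (Space d))) :
    interaction μ = (mutualEnergy (μ : Measure (Space d)) (μ : Measure (Space d)) : EReal) -
      ((2 * ∫ y, logWeight y ∂(μ : Measure (Space d)) : ℝ) : EReal) := by
  have h := extIntegral_eq_sub (m := (μ : Measure (Space d)).prod (μ : Measure (Space d)))
    (f := fun z => kernel d (z.1 - z.2)) (F := posKernel d)
    (c := fun z => logWeight z.1 + logWeight z.2)
    (measurable_posKernel hd)
    ((continuous_logWeight.comp continuous_fst).add
      (continuous_logWeight.comp continuous_snd)).measurable
    (fun z => add_nonneg (logWeight_nonneg z.1) (logWeight_nonneg z.2))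
    (integrable_logWeight_prod hμ hμ) (fun z => kernel_add_logWeight hd z.1 z.2)
  rw [interaction, h, integral_logWeight_prod hμ hμ, ← two_mul, mutualEnergy]

end Confining

lemma coe_ennreal_sub_coe_lt_top_iff (A : ℝ≥0∞) (M : ℝ) :
    (A : EReal) - (M : EReal) < ⊤ ↔ A ≠ ⊤ := by
  by_cases hA : A = ⊤
  · subst hA
    simp only [EReal.coe_ennreal_top, EReal.top_sub_coe, lt_irrefl, ne_eq, not_true]
  · lift A to ℝ≥0 using hA
    refine iff_of_true ?_ ENNReal.coe_ne_top
    exact EReal.coe_lt_top ((A : ℝ) - M)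

lemma coe_ennreal_sub_coe_le_iff (A B : ℝ≥0∞) (M : ℝ) :
    (A : EReal) - (M : EReal) ≤ (B : EReal) - (M : EReal) ↔ A ≤ B := by
  constructor
  · intro h
    have := add_le_add_left h (M : EReal)
    rwa [EReal.sub_add_cancel, EReal.sub_add_cancel, EReal.coe_ennreal_le_coe_ennreal_iff] at this
  · intro h
    exact EReal.sub_le_sub (EReal.coe_ennreal_le_coe_ennreal_iff.2 h) le_rfl

lemma coe_ennreal_sub_coe_eq {A : ℝ≥0∞} (hA : A ≠ ⊤) (M : ℝ) :
    (A : EReal) - (M : EReal) = ((A.toReal - M : ℝ) : EReal) := by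
  lift A to ℝ≥0 using hA
  rfl

section Mix

variable {d : ℕ}

/-- The mixture `s μ + t ν` of two probability measures. -/
def mix (s t : ℝ≥0∞) (h : s + t = 1) (μ ν : ProbabilityMeasure (Space d)) :
    ProbabilityMeasure (Space d) :=
  ⟨s • (μ : Measure (Space d)) + t • (ν : Measure (Space d)), ⟨by simp [h]⟩⟩

lemma coe_mix (s t : ℝ≥0∞) (h : s + t = 1) (μ ν : ProbabilityMeasure (Space d)) :
    (mix s t h μ ν : Measure (Space d)) =
      s • (μ : Measure (Space d)) + t • (ν : Measure (Space d)) := rfl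

lemma mutualEnergy_smul_add_smul (s t : ℝ≥0∞) (μ ν : Measure (Space d)) [SFinite μ] [SFinite ν] :
    mutualEnergy (s • μ + t • ν) (s • μ + t • ν) =
      s * s * mutualEnergy μ μ + 2 * (s * t) * mutualEnergy μ ν + t * t * mutualEnergy ν ν := by
  have h := mutualEnergy_comm ν μ
  simp only [mutualEnergy] at h ⊢
  rw [Measure.prod_add, Measure.add_prod, Measure.add_prod]
  simp only [Measure.prod_smul_left, Measure.prod_smul_right, lintegral_add_measure,
    lintegral_smul_measure, smul_eq_mul, h]
  ring

lemma shiftedEnergy_mix (V : Space d → ℝ) (M : ℝ) (s t : ℝ≥0∞) (h : s + t = 1)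
    (μ ν : ProbabilityMeasure (Space d)) :
    shiftedEnergy V M (mix s t h μ ν : Measure (Space d)) =
      s * s * mutualEnergy (μ : Measure (Space d)) μ
        + 2 * (s * t) * mutualEnergy (μ : Measure (Space d)) ν
        + t * t * mutualEnergy (ν : Measure (Space d)) ν
        + (s * ∫⁻ x, shiftedPotential V M x ∂(μ : Measure (Space d))
          + t * ∫⁻ x, shiftedPotential V M x ∂(ν : Measure (Space d))) := by
  rw [shiftedEnergy, coe_mix, mutualEnergy_smul_add_smul, lintegral_add_measure,
    lintegral_smul_measure, lintegral_smul_measure, smul_eq_mul, smul_eq_mul]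

lemma exists_shiftedEnergy_mix_add_le (hd : 2 ≤ d) (V : Space d → ℝ) (M : ℝ) (s t : ℝ≥0∞)
    (h : s + t = 1) {μ ν : ProbabilityMeasure (Space d)}
    (hμ : Integrable logWeight (μ : Measure (Space d)))
    (hν : Integrable logWeight (ν : Measure (Space d))) :
    ∃ D : ℝ≥0∞, (μ ≠ ν → 0 < D) ∧
      shiftedEnergy V M (mix s t h μ ν : Measure (Space d)) + s * t * D ≤
        s * shiftedEnergy V M (μ : Measure (Space d))
          + t * shiftedEnergy V M (ν : Measure (Space d)) := by
  obtain ⟨D, hD, hle⟩ := two_mul_mutualEnergy_add_le hd hμ hν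
  refine ⟨D, fun hne => hD fun heq => hne (Subtype.ext heq), ?_⟩
  rw [shiftedEnergy_mix, shiftedEnergy, shiftedEnergy]
  set a := mutualEnergy (μ : Measure (Space d)) μ
  set c := mutualEnergy (μ : Measure (Space d)) ν
  set n := mutualEnergy (ν : Measure (Space d)) ν
  set w := ∫⁻ x, shiftedPotential V M x ∂(μ : Measure (Space d))
  set w' := ∫⁻ x, shiftedPotential V M x ∂(ν : Measure (Space d))
  calc s * s * a + 2 * (s * t) * c + t * t * n + (s * w + t * w') + s * t * D
      = s * s * a + t * t * n + (s * w + t * w') + s * t * (2 * c + D) := by ring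
    _ ≤ s * s * a + t * t * n + (s * w + t * w') + s * t * (a + n) := by gcongr
    _ = (s + t) * s * a + (s + t) * t * n + (s * w + t * w') := by ring
    _ = s * (a + w) + t * (n + w') := by rw [h]; ring

variable {V : Space d → ℝ} {q b M : ℝ}

lemma lintegral_shiftedPotential_ne_top {μ : Measure (Space d)} (h : shiftedEnergy V M μ ≠ ⊤) :
    ∫⁻ x, shiftedPotential V M x ∂μ ≠ ⊤ := (ENNReal.add_ne_top.1 h).2

lemma mutualEnergy_ne_top {μ : Measure (Space d)} (h : shiftedEnergy V M μ ≠ ⊤) :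
    mutualEnergy μ μ ≠ ⊤ := (ENNReal.add_ne_top.1 h).1

lemma Confining.shiftedEnergy_mix_le (hV : Confining V q b M) (hd : 2 ≤ d) (s t : ℝ≥0∞)
    (h : s + t = 1) {μ ν : ProbabilityMeasure (Space d)}
    (hμ : shiftedEnergy V M (μ : Measure (Space d)) ≠ ⊤)
    (hν : shiftedEnergy V M (ν : Measure (Space d)) ≠ ⊤) :
    shiftedEnergy V M (mix s t h μ ν : Measure (Space d)) ≤
      s * shiftedEnergy V M (μ : Measure (Space d))
        + t * shiftedEnergy V M (ν : Measure (Space d)) := by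
  obtain ⟨D, -, hD⟩ := exists_shiftedEnergy_mix_add_le hd V M s t h
    (hV.integrable_logWeight (lintegral_shiftedPotential_ne_top hμ))
    (hV.integrable_logWeight (lintegral_shiftedPotential_ne_top hν))
  exact le_self_add.trans hD

/-- Strict convexity of the energy, at midpoints of measures of equal energy. -/
lemma Confining.exists_shiftedEnergy_mix_lt (hV : Confining V q b M) (hd : 2 ≤ d)
    {μ ν : ProbabilityMeasure (Space d)}
    (hμ : shiftedEnergy V M (μ : Measure (Space d)) ≠ ⊤)
    (hμν : shiftedEnergy V M (μ : Measure (Space d)) = shiftedEnergy V M (ν : Measure (Space d)))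
    (hne : μ ≠ ν) :
    shiftedEnergy V M (mix 2⁻¹ 2⁻¹ ENNReal.inv_two_add_inv_two μ ν : Measure (Space d)) <
      shiftedEnergy V M (μ : Measure (Space d)) := by
  obtain ⟨D, hD0, hD⟩ := exists_shiftedEnergy_mix_add_le hd V M 2⁻¹ 2⁻¹
    ENNReal.inv_two_add_inv_two
    (hV.integrable_logWeight (lintegral_shiftedPotential_ne_top hμ))
    (hV.integrable_logWeight (lintegral_shiftedPotential_ne_top (hμν ▸ hμ)))
  rw [← hμν, ← add_mul, ENNReal.inv_two_add_inv_two, one_mul] at hD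
  have hpos : 0 < (2⁻¹ : ℝ≥0∞) * 2⁻¹ * D := by
    have := hD0 hne
    have h2 : (0 : ℝ≥0∞) < 2⁻¹ := by simp
    exact ENNReal.mul_pos (ENNReal.mul_pos h2.ne' h2.ne').ne' this.ne'
  refine lt_of_lt_of_le (ENNReal.lt_add_right ?_ hpos.ne') hD
  exact ne_top_of_le_ne_top hμ (le_self_add.trans hD)

end Mix

section Semicontinuity

variable {X : Type*} [TopologicalSpace X] [MeasurableSpace X] [BorelSpace X]

lemma lintegral_ofReal_le_liminf [HasOuterApproxClosed X] {f : X → ℝ}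
    (hf : LowerSemicontinuous f) (hf0 : 0 ≤ f) {μs : ℕ → ProbabilityMeasure X}
    {μ : ProbabilityMeasure X} (hμ : Tendsto μs atTop (𝓝 μ)) :
    ∫⁻ x, ENNReal.ofReal (f x) ∂(μ : Measure X) ≤
      atTop.liminf fun i => ∫⁻ x, ENNReal.ofReal (f x) ∂(μs i : Measure X) := by
  simp_rw [lintegral_eq_lintegral_meas_lt _ (Eventually.of_forall hf0) hf.measurable.aemeasurable]
  calc ∫⁻ t in Ioi (0 : ℝ), (μ : Measure X) {a | t < f a}
      ≤ ∫⁻ t in Ioi (0 : ℝ), atTop.liminf fun i => (μs i : Measure X) {a | t < f a} :=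
        lintegral_mono fun t =>
          ProbabilityMeasure.le_liminf_measure_open_of_tendsto hμ (hf.isOpen_preimage t)
    _ ≤ atTop.liminf fun i => ∫⁻ t in Ioi (0 : ℝ), (μs i : Measure X) {a | t < f a} :=
        lintegral_liminf_le fun n => Antitone.measurable fun s t hst =>
          measure_mono fun ω hω => lt_of_le_of_lt hst hω

lemma continuous_min_toReal (N : ℝ≥0) : Continuous fun z : ℝ≥0∞ => (min z N).toReal :=
  ENNReal.continuousOn_toReal.comp_continuous (continuous_id.min continuous_const)
    fun _ => ne_top_of_le_ne_top ENNReal.coe_ne_top (min_le_right _ _)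

lemma monotone_min_toReal (N : ℝ≥0) : Monotone fun z : ℝ≥0∞ => (min z N).toReal :=
  fun _ _ h => ENNReal.toReal_mono
    (ne_top_of_le_ne_top ENNReal.coe_ne_top (min_le_right _ _)) (min_le_min_right _ h)

/-- Integration against a nonnegative lower semicontinuous function is lower semicontinuous for
the weak topology. -/
lemma lowerSemicontinuous_lintegral [HasOuterApproxClosed X]
    [SequentialSpace (ProbabilityMeasure X)] {f : X → ℝ≥0∞} (hf : LowerSemicontinuous f) :
    LowerSemicontinuous fun μ : ProbabilityMeasure X => ∫⁻ x, f x ∂(μ : Measure X) := by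
  have hfN : ∀ N : ℕ, LowerSemicontinuous fun x => (min (f x) (N : ℝ≥0)).toReal := fun N =>
    (continuous_min_toReal N).comp_lowerSemicontinuous hf (monotone_min_toReal N)
  have hof : ∀ (N : ℕ) (x : X), ENNReal.ofReal (min (f x) (N : ℝ≥0)).toReal = min (f x) N :=
    fun N x => by
      rw [ENNReal.ofReal_toReal]
      · simp
      · exact ne_top_of_le_ne_top ENNReal.coe_ne_top (min_le_right _ _)
  have heq : ∀ μ : ProbabilityMeasure X, ∫⁻ x, f x ∂(μ : Measure X) =
      ⨆ N : ℕ, ∫⁻ x, ENNReal.ofReal (min (f x) (N : ℝ≥0)).toReal ∂(μ : Measure X) := fun μ => by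
    rw [← lintegral_iSup]
    · refine lintegral_congr fun x => ?_
      simp_rw [hof]
      rw [← inf_iSup_eq, ENNReal.iSup_natCast, inf_top_eq]
    · exact fun N => (hfN N).measurable.ennreal_ofReal
    · intro N N' h x
      simp only [hof]
      exact min_le_min_left _ (by exact_mod_cast h)
  simp_rw [heq]
  refine lowerSemicontinuous_iSup fun N => ?_
  rw [lowerSemicontinuous_iff_isClosed_preimage]
  intro c
  refine IsSeqClosed.isClosed fun μs μ hμs hμ => ?_
  have h := lintegral_ofReal_le_liminf (hfN N) (fun x => ENNReal.toReal_nonneg) hμ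
  refine h.trans (liminf_le_of_frequently_le' (Eventually.of_forall hμs).frequently)

end Semicontinuity

section Existence

variable {d : ℕ} {V : Space d → ℝ} {q b M : ℝ}

lemma Confining.lowerSemicontinuous_shiftedEnergy (hV : Confining V q b M) (hd : 2 ≤ d) :
    LowerSemicontinuous fun μ : ProbabilityMeasure (Space d) =>
      shiftedEnergy V M (μ : Measure (Space d)) := by
  refine LowerSemicontinuous.add ?_
    (lowerSemicontinuous_lintegral hV.lowerSemicontinuous_shiftedPotential)
  have h1 := lowerSemicontinuous_lintegral (lowerSemicontinuous_posKernel hd)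
  have h2 : Continuous fun μ : ProbabilityMeasure (Space d) => μ.prod μ :=
    ProbabilityMeasure.continuous_prod.comp (continuous_id.prodMk continuous_id)
  exact h1.comp h2

lemma isTightMeasureSet_of_lintegral_rpow_norm_le {q : ℝ} (hq : 1 < q) {c : ℝ≥0∞} (hc : c ≠ ⊤)
    {S : Set (Measure (Space d))}
    (h : ∀ μ ∈ S, ∫⁻ x, ENNReal.ofReal (‖x‖ ^ q) ∂μ ≤ c) : IsTightMeasureSet S := by
  rw [isTightMeasureSet_iff_exists_isCompact_measure_compl_le]
  intro ε hε
  by_cases hεt : ε = ⊤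
  · exact ⟨∅, isCompact_empty, fun μ _ => by simp [hεt]⟩
  set r : ℝ := max 1 (c / ε).toReal
  have hr1 : 1 ≤ r := le_max_left _ _
  refine ⟨Metric.closedBall 0 r, isCompact_closedBall _ _, fun μ hμ => ?_⟩
  have hr : c ≤ ENNReal.ofReal r * ε := by
    rw [← ENNReal.div_le_iff hε.ne' hεt]
    have hfin : c / ε ≠ ⊤ := ENNReal.div_ne_top hc hε.ne'
    rw [← ENNReal.ofReal_toReal hfin]
    exact ENNReal.ofReal_le_ofReal (le_max_right _ _)
  have hsub : (Metric.closedBall (0 : Space d) r)ᶜ ⊆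
      {x | ENNReal.ofReal r ≤ ENNReal.ofReal (‖x‖ ^ q)} := by
    intro x hx
    simp only [mem_compl_iff, Metric.mem_closedBall, dist_zero_right, not_le] at hx
    refine ENNReal.ofReal_le_ofReal (hx.le.trans ?_)
    exact Real.self_le_rpow_of_one_le (hr1.trans hx.le) hq.le
  have hr0 : ENNReal.ofReal r ≠ 0 := by
    rw [Ne, ENNReal.ofReal_eq_zero, not_le]; linarith
  calc μ (Metric.closedBall 0 r)ᶜ ≤ μ {x | ENNReal.ofReal r ≤ ENNReal.ofReal (‖x‖ ^ q)} :=
        measure_mono hsub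
    _ ≤ (∫⁻ x, ENNReal.ofReal (‖x‖ ^ q) ∂μ) / ENNReal.ofReal r :=
        meas_ge_le_lintegral_div (Measurable.aemeasurable (by fun_prop)) hr0
          ENNReal.ofReal_ne_top
    _ ≤ c / ENNReal.ofReal r := by gcongr; exact h μ hμ
    _ ≤ ε := ENNReal.div_le_of_le_mul' hr

/-- The direct method for the energy. -/
lemma Confining.exists_minimizer (hV : Confining V q b M) (hd : 2 ≤ d)
    {A : Set (ProbabilityMeasure (Space d))}
    (hA : ∀ c : ℝ≥0∞, c ≠ ⊤ →
      IsClosed (A ∩ {μ | shiftedEnergy V M (μ : Measure (Space d)) ≤ c}))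
    (hne : ∃ μ ∈ A, shiftedEnergy V M (μ : Measure (Space d)) ≠ ⊤) :
    ∃ μ ∈ A, shiftedEnergy V M (μ : Measure (Space d)) ≠ ⊤ ∧
      ∀ ν ∈ A, shiftedEnergy V M (μ : Measure (Space d)) ≤
        shiftedEnergy V M (ν : Measure (Space d)) := by
  obtain ⟨μ₀, hμ₀, hfin⟩ := hne
  set c := shiftedEnergy V M (μ₀ : Measure (Space d)) with hc
  set S := A ∩ {μ | shiftedEnergy V M (μ : Measure (Space d)) ≤ c} with hS
  have hcomp : IsCompact S := by
    have hcl : closure S = S := (hA c hfin).closure_eq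
    rw [← hcl]
    refine isCompact_closure_of_isTightMeasureSet ?_
    refine isTightMeasureSet_of_lintegral_rpow_norm_le hV.one_lt
      (c := ENNReal.ofReal b⁻¹ * c) (ENNReal.mul_ne_top ENNReal.ofReal_ne_top hfin) ?_
    rintro _ ⟨μ, hμ, rfl⟩
    exact (hV.lintegral_rpow_norm_le _).trans (mul_le_mul_right hμ.2 _)
  obtain ⟨μ, hμ, hmin⟩ := LowerSemicontinuousOn.exists_isMinOn (s := S) ⟨μ₀, hμ₀, hc.ge⟩ hcomp
    ((hV.lowerSemicontinuous_shiftedEnergy hd).lowerSemicontinuousOn S)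
  refine ⟨μ, hμ.1, ne_top_of_le_ne_top hfin hμ.2, fun ν hν => ?_⟩
  by_cases h : shiftedEnergy V M (ν : Measure (Space d)) ≤ c
  · exact isMinOn_iff.1 hmin ν ⟨hν, h⟩
  · exact hμ.2.trans (not_le.1 h).le

lemma Confining.isClosed_constraint (hV : Confining V q b M) (hd : 2 ≤ d) {φ : Space d → ℝ}
    {L : ℝ≥0} (hφ : LipschitzWith L φ) {c : ℝ≥0∞} (hc : c ≠ ⊤) :
    IsClosed ({μ : ProbabilityMeasure (Space d) | ∫ x, φ x ∂(μ : Measure (Space d)) ≤ 0} ∩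
      {μ | shiftedEnergy V M (μ : Measure (Space d)) ≤ c}) := by
  have hq0 : 0 < q := by linarith [hV.one_lt]
  have hex : ∀ n : ℕ, ∃ C : ℝ, 0 ≤ C ∧ ∀ x : Space d, 0 ≤ φ x + 1 / ((n : ℝ) + 1) * ‖x‖ ^ q + C := by
    intro n
    obtain ⟨R', h⟩ := exists_growth_add_lipschitz (V := fun x : Space d =>
      1 / ((n : ℝ) + 1) * ‖x‖ ^ q) (R := 0) (one_div_succ_pos n) hV.one_lt (by simp) hφ
      zero_le_one
    refine ⟨|R'|, abs_nonneg _, fun x => ?_⟩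
    have h1 := h x
    have h2 := le_abs_self R'
    have : 0 ≤ 1 / ((n : ℝ) + 1) / 2 * ‖x‖ ^ q := by positivity
    linarith
  choose C hC0 hC using hex
  set c' : ℝ := b⁻¹ * c.toReal with hc'
  have hbound : ∀ μ : ProbabilityMeasure (Space d),
      shiftedEnergy V M (μ : Measure (Space d)) ≤ c →
      Integrable (fun x => ‖x‖ ^ q) (μ : Measure (Space d)) ∧
      Integrable φ (μ : Measure (Space d)) ∧
      ∫ x, ‖x‖ ^ q ∂(μ : Measure (Space d)) ≤ c' := by
    intro μ hμ
    have hfin := lintegral_shiftedPotential_ne_top (ne_top_of_le_ne_top hc hμ)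
    have hi := hV.integrable_rpow_norm hfin
    refine ⟨hi, integrable_lipschitz hφ (hV.integrable_norm hfin), ?_⟩
    have h1 := (hV.lintegral_rpow_norm_le (μ : Measure (Space d))).trans
      (mul_le_mul_right hμ (ENNReal.ofReal b⁻¹))
    rw [← ofReal_integral_eq_lintegral_ofReal hi (ae_of_all _ fun x => by positivity),
      ← ENNReal.ofReal_toReal hc, ← ENNReal.ofReal_mul (inv_nonneg.2 hV.pos.le),
      ENNReal.ofReal_le_ofReal_iff
        (mul_nonneg (inv_nonneg.2 hV.pos.le) ENNReal.toReal_nonneg)] at h1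
    exact h1
  have key : ∀ (n : ℕ) (μ : ProbabilityMeasure (Space d)),
      shiftedEnergy V M (μ : Measure (Space d)) ≤ c →
      ∫⁻ x, ENNReal.ofReal (φ x + 1 / ((n : ℝ) + 1) * ‖x‖ ^ q + C n) ∂(μ : Measure (Space d)) =
        ENNReal.ofReal (∫ x, φ x ∂(μ : Measure (Space d)) +
          1 / ((n : ℝ) + 1) * ∫ x, ‖x‖ ^ q ∂(μ : Measure (Space d)) + C n) := by
    intro n μ hμ
    obtain ⟨h1, h2, -⟩ := hbound μ hμ
    have h3 := h1.const_mul (1 / ((n : ℝ) + 1))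
    rw [← ofReal_integral_eq_lintegral_ofReal
      (f := fun x => φ x + 1 / ((n : ℝ) + 1) * ‖x‖ ^ q + C n)
      ((h2.add h3).add (integrable_const _)) (ae_of_all _ (hC n)),
      integral_add (f := fun x => φ x + 1 / ((n : ℝ) + 1) * ‖x‖ ^ q) (h2.add h3)
        (integrable_const _), integral_add h2 h3, integral_const_mul, integral_const]
    simp
  have heq : ({μ : ProbabilityMeasure (Space d) | ∫ x, φ x ∂(μ : Measure (Space d)) ≤ 0} ∩
      {μ | shiftedEnergy V M (μ : Measure (Space d)) ≤ c}) =
      (⋂ n : ℕ, {μ : ProbabilityMeasure (Space d) |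
        ∫⁻ x, ENNReal.ofReal (φ x + 1 / ((n : ℝ) + 1) * ‖x‖ ^ q + C n) ∂(μ : Measure (Space d)) ≤
          ENNReal.ofReal (1 / ((n : ℝ) + 1) * c' + C n)}) ∩
      {μ | shiftedEnergy V M (μ : Measure (Space d)) ≤ c} := by
    ext μ
    refine and_congr_left fun hμ => ?_
    have hμ' : shiftedEnergy V M (μ : Measure (Space d)) ≤ c := hμ
    obtain ⟨h1, h2, h3⟩ := hbound μ hμ
    have hq0 : 0 ≤ ∫ x, ‖x‖ ^ q ∂(μ : Measure (Space d)) := integral_nonneg fun x => by positivity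
    simp only [mem_iInter, mem_ofPred_eq, key _ μ hμ']
    constructor
    · intro h n
      refine ENNReal.ofReal_le_ofReal ?_
      have := mul_le_mul_of_nonneg_left h3 (one_div_succ_pos n).le
      linarith
    · intro h
      have hn : ∀ n : ℕ, ∫ x, φ x ∂(μ : Measure (Space d)) ≤ 1 / ((n : ℝ) + 1) * c' := by
        intro n
        have h0 : 0 ≤ c' := hq0.trans h3
        have h4 := one_div_succ_pos n
        have h5 := (ENNReal.ofReal_le_ofReal_iff
          (add_nonneg (mul_nonneg h4.le h0) (hC0 n))).1 (h n)
        have h6 := mul_nonneg h4.le hq0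
        linarith
      refine ge_of_tendsto' (f := fun n : ℕ => 1 / ((n : ℝ) + 1) * c') (x := atTop) ?_ hn
      simpa using tendsto_one_div_add_atTop_nhds_zero_nat.mul_const c'
  rw [heq]
  refine IsClosed.inter (isClosed_iInter fun n => ?_) ?_
  · have hcont : Continuous fun x : Space d => φ x + 1 / ((n : ℝ) + 1) * ‖x‖ ^ q + C n := by
      have h1 := hφ.continuous
      have h2 : Continuous fun x : Space d => ‖x‖ ^ q :=
        continuous_norm.rpow_const fun x => Or.inr hq0.le
      fun_prop
    exact (lowerSemicontinuous_lintegral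
      (ENNReal.continuous_ofReal.comp hcont).lowerSemicontinuous).isClosed_preimage _
  · exact (hV.lowerSemicontinuous_shiftedEnergy hd).isClosed_preimage c

end Existence

section EulerLagrange

variable {d : ℕ} {V : Space d → ℝ} {q b M : ℝ}

/-- The potential of a measure for the compensated kernel. -/
def posPotential (μ : Measure (Space d)) (x : Space d) : ℝ≥0∞ := ∫⁻ y, posKernel d (x, y) ∂μ

/-- The effective potential `2 g * μ + V`, shifted to be nonnegative. -/
def effectivePotential (V : Space d → ℝ) (M : ℝ) (μ : Measure (Space d)) (x : Space d) : ℝ≥0∞ :=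
  2 * posPotential μ x + shiftedPotential V M x

lemma lowerSemicontinuous_posPotential (hd : 2 ≤ d) (μ : Measure (Space d)) :
    LowerSemicontinuous (posPotential μ) := by
  rw [lowerSemicontinuous_iff_isClosed_preimage]
  intro c
  refine IsSeqClosed.isClosed fun xs x hxs hx => ?_
  have h1 : ∀ y, posKernel d (x, y) ≤ atTop.liminf fun n => posKernel d (xs n, y) := fun y => by
    have h := (lowerSemicontinuous_posKernel hd).le_liminf (x, y)
    have h2 : Tendsto (fun n => (xs n, y)) atTop (𝓝 (x, y)) :=
      hx.prodMk_nhds tendsto_const_nhds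
    refine h.trans ?_
    exact Filter.liminf_le_liminf_of_le h2
  have h2 : posPotential μ x ≤ atTop.liminf fun n => posPotential μ (xs n) :=
    (lintegral_mono h1).trans (lintegral_liminf_le fun n =>
      (measurable_posKernel hd).comp (by fun_prop))
  exact h2.trans (liminf_le_of_frequently_le' (Eventually.of_forall hxs).frequently)

lemma Confining.lowerSemicontinuous_effectivePotential (hV : Confining V q b M) (hd : 2 ≤ d)
    (μ : Measure (Space d)) : LowerSemicontinuous (effectivePotential V M μ) := by
  have h := lowerSemicontinuous_posPotential hd μ
  refine LowerSemicontinuous.add ?_ hV.lowerSemicontinuous_shiftedPotential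
  simp_rw [two_mul]
  exact h.add h

lemma lintegral_posPotential (hd : 2 ≤ d) (μ ν : Measure (Space d)) [SFinite μ] [SFinite ν] :
    ∫⁻ x, posPotential μ x ∂ν = mutualEnergy μ ν := by
  rw [mutualEnergy_comm, mutualEnergy, lintegral_prod _ (measurable_posKernel hd).aemeasurable]
  rfl

lemma Confining.lintegral_effectivePotential (hV : Confining V q b M) (hd : 2 ≤ d)
    (μ ν : Measure (Space d)) [SFinite μ] [SFinite ν] :
    ∫⁻ x, effectivePotential V M μ x ∂ν =
      2 * mutualEnergy μ ν + ∫⁻ x, shiftedPotential V M x ∂ν := by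
  unfold effectivePotential
  rw [lintegral_add_right _ hV.measurable_shiftedPotential, lintegral_const_mul _
    (lowerSemicontinuous_posPotential hd μ).measurable, lintegral_posPotential hd]

lemma nonneg_of_forall_mul_add_sq_nonneg {A B : ℝ}
    (h : ∀ t : ℝ, 0 < t → t < 1 → 0 ≤ t * A + t ^ 2 * B) : 0 ≤ A := by
  have h1 : ∀ n : ℕ, 0 ≤ A + 1 / ((n : ℝ) + 1 + 1) * B := fun n => by
    have hn : (0 : ℝ) ≤ n := n.cast_nonneg
    have ht : 0 < 1 / ((n : ℝ) + 1 + 1) := by positivity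
    have h2 := h _ ht (by rw [div_lt_one (by positivity)]; linarith)
    rw [pow_two, mul_assoc, ← mul_add] at h2
    exact nonneg_of_mul_nonneg_right h2 ht
  have h2 : Tendsto (fun n : ℕ => A + 1 / ((n : ℝ) + 1 + 1) * B) atTop (𝓝 (A + 0 * B)) := by
    refine Tendsto.const_add _ (Tendsto.mul_const _ ?_)
    have := (tendsto_add_atTop_iff_nat 1).2 (tendsto_one_div_add_atTop_nhds_zero_nat (𝕜 := ℝ))
    simpa using this
  rw [zero_mul, add_zero] at h2
  exact ge_of_tendsto' h2 h1

/-- First order optimality of an energy minimizer. -/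
lemma Confining.lintegral_effectivePotential_le (hV : Confining V q b M) (hd : 2 ≤ d)
    {μ ν : ProbabilityMeasure (Space d)}
    (hμ : shiftedEnergy V M (μ : Measure (Space d)) ≠ ⊤)
    (hmin : ∀ ρ : ProbabilityMeasure (Space d),
      shiftedEnergy V M (μ : Measure (Space d)) ≤ shiftedEnergy V M (ρ : Measure (Space d)))
    (hν : shiftedEnergy V M (ν : Measure (Space d)) ≠ ⊤) :
    ∫⁻ x, effectivePotential V M (μ : Measure (Space d)) x ∂(μ : Measure (Space d)) ≤
      ∫⁻ x, effectivePotential V M (μ : Measure (Space d)) x ∂(ν : Measure (Space d)) := by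
  rw [hV.lintegral_effectivePotential hd, hV.lintegral_effectivePotential hd]
  have ha := mutualEnergy_ne_top hμ
  have hn := mutualEnergy_ne_top hν
  have hw := lintegral_shiftedPotential_ne_top hμ
  have hw' := lintegral_shiftedPotential_ne_top hν
  have hc : mutualEnergy (μ : Measure (Space d)) (ν : Measure (Space d)) ≠ ⊤ := by
    obtain ⟨D, -, hD⟩ := two_mul_mutualEnergy_add_le hd (hV.integrable_logWeight hw)
      (hV.integrable_logWeight hw')
    intro htop
    rw [htop, ENNReal.mul_top two_ne_zero, top_add, top_le_iff] at hD
    exact ENNReal.add_ne_top.2 ⟨ha, hn⟩ hD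
  have key : ∀ t : ℝ, 0 < t → t < 1 → ∀ h : ENNReal.ofReal (1 - t) + ENNReal.ofReal t = 1,
      shiftedEnergy V M (μ : Measure (Space d)) ≤ shiftedEnergy V M
        (mix (ENNReal.ofReal (1 - t)) (ENNReal.ofReal t) h μ ν : Measure (Space d)) :=
    fun t _ _ h => hmin _
  simp only [shiftedEnergy_mix] at key
  simp only [shiftedEnergy] at key
  revert key
  generalize mutualEnergy (μ : Measure (Space d)) (μ : Measure (Space d)) = a at ha ⊢
  generalize mutualEnergy (ν : Measure (Space d)) (ν : Measure (Space d)) = n at hn ⊢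
  generalize mutualEnergy (μ : Measure (Space d)) (ν : Measure (Space d)) = c at hc ⊢
  generalize ∫⁻ x, shiftedPotential V M x ∂(μ : Measure (Space d)) = w at hw ⊢
  generalize ∫⁻ x, shiftedPotential V M x ∂(ν : Measure (Space d)) = w' at hw' ⊢
  intro key
  lift a to ℝ≥0 using ha
  lift n to ℝ≥0 using hn
  lift c to ℝ≥0 using hc
  lift w to ℝ≥0 using hw
  lift w' to ℝ≥0 using hw'
  have h0 : 0 ≤ (2 * (c : ℝ) + w') - (2 * a + w) := by
    refine nonneg_of_forall_mul_add_sq_nonneg (B := (a : ℝ) - 2 * c + n) fun t ht ht1 => ?_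
    have hs : 0 ≤ 1 - t := by linarith
    have hst : ENNReal.ofReal (1 - t) + ENNReal.ofReal t = 1 := by
      rw [← ENNReal.ofReal_add hs ht.le]; simp
    have h1 := key t ht ht1 hst
    lift t to ℝ≥0 using ht.le
    generalize hse : 1 - (t : ℝ) = s at *
    lift s to ℝ≥0 using hs
    simp only [ENNReal.ofReal_coe_nnreal] at h1
    have h2 : (a : ℝ) + w ≤ s * s * a + 2 * (s * t) * c + t * t * n + (s * w + t * w') := by
      exact_mod_cast h1
    rw [← hse] at h2
    nlinarith
  have h1 : (2 * (a : ℝ) + w) ≤ 2 * c + w' := by linarith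
  exact_mod_cast h1

/-- A probability measure of finite mutual energy does not live where the effective potential is
below its mean value. -/
lemma Confining.not_ae_effectivePotential_lt (hV : Confining V q b M) (hd : 2 ≤ d)
    {μ ν : ProbabilityMeasure (Space d)}
    (hμ : shiftedEnergy V M (μ : Measure (Space d)) ≠ ⊤)
    (hmin : ∀ ρ : ProbabilityMeasure (Space d),
      shiftedEnergy V M (μ : Measure (Space d)) ≤ shiftedEnergy V M (ρ : Measure (Space d)))
    (hν : mutualEnergy (ν : Measure (Space d)) (ν : Measure (Space d)) ≠ ⊤) :
    ¬ ∀ᵐ x ∂(ν : Measure (Space d)), effectivePotential V M (μ : Measure (Space d)) x <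
      ∫⁻ x, effectivePotential V M (μ : Measure (Space d)) x ∂(μ : Measure (Space d)) := by
  intro hlt
  set C := ∫⁻ x, effectivePotential V M (μ : Measure (Space d)) x ∂(μ : Measure (Space d)) with hC
  by_cases hCt : C = ⊤
  · rw [hCt, hV.lintegral_effectivePotential hd] at hC
    exact ENNReal.add_ne_top.2 ⟨ENNReal.mul_ne_top ENNReal.ofNat_ne_top (mutualEnergy_ne_top hμ),
      lintegral_shiftedPotential_ne_top hμ⟩ hC.symm
  have hle : ∫⁻ x, effectivePotential V M (μ : Measure (Space d)) x ∂(ν : Measure (Space d)) ≤ C := by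
    refine (lintegral_mono_ae (hlt.mono fun x hx => hx.le)).trans ?_
    simp
  have hfin : shiftedEnergy V M (ν : Measure (Space d)) ≠ ⊤ := by
    refine ENNReal.add_ne_top.2 ⟨hν, ne_top_of_le_ne_top hCt (le_trans ?_ hle)⟩
    exact lintegral_mono fun x => le_add_self
  have h1 := lintegral_strict_mono (IsProbabilityMeasure.ne_zero (ν : Measure (Space d)))
    aemeasurable_const (ne_top_of_le_ne_top hCt hle) hlt
  rw [lintegral_const, measure_univ, mul_one] at h1
  exact absurd h1 (not_lt.2 (hV.lintegral_effectivePotential_le hd hμ hmin hfin))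

lemma integrable_logWeight_of_compact {K : Set (Space d)} (hK : IsCompact K)
    (ν : ProbabilityMeasure (Space d)) (hν : (ν : Measure (Space d)).support ⊆ K) :
    Integrable logWeight (ν : Measure (Space d)) := by
  obtain ⟨C, hC⟩ := hK.exists_bound_of_continuousOn continuous_logWeight.continuousOn
  refine Integrable.of_bound continuous_logWeight.aestronglyMeasurable C ?_
  filter_upwards [Measure.support_mem_ae (μ := (ν : Measure (Space d)))] with x hx
  exact hC x (hν hx)

lemma Confining.not_hasPositiveCapacity (hV : Confining V q b M) (hd : 2 ≤ d)
    {μ : ProbabilityMeasure (Space d)}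
    (hμ : shiftedEnergy V M (μ : Measure (Space d)) ≠ ⊤)
    (hmin : ∀ ρ : ProbabilityMeasure (Space d),
      shiftedEnergy V M (μ : Measure (Space d)) ≤ shiftedEnergy V M (ρ : Measure (Space d))) :
    ¬ HasPositiveCapacity {x | effectivePotential V M (μ : Measure (Space d)) x <
      ∫⁻ x, effectivePotential V M (μ : Measure (Space d)) x ∂(μ : Measure (Space d))} := by
  rintro ⟨K, hK, hKN, ν, hνK, hν⟩
  rw [interaction_eq hd (integrable_logWeight_of_compact hK ν hνK),
    coe_ennreal_sub_coe_lt_top_iff] at hν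
  refine hV.not_ae_effectivePotential_lt hd hμ hmin hν ?_
  filter_upwards [Measure.support_mem_ae (μ := (ν : Measure (Space d)))] with x hx
  exact hKN (hνK hx)

lemma mutualEnergy_smul_restrict_ne_top {μ : Measure (Space d)} [SFinite μ]
    (hμ : mutualEnergy μ μ ≠ ⊤) (N : Set (Space d)) {c : ℝ≥0∞} (hc : c ≠ ⊤) :
    mutualEnergy (c • μ.restrict N) (c • μ.restrict N) ≠ ⊤ := by
  rw [mutualEnergy, Measure.prod_smul_left, Measure.prod_smul_right, lintegral_smul_measure,
    lintegral_smul_measure, Measure.prod_restrict]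
  refine ENNReal.mul_ne_top hc (ENNReal.mul_ne_top hc ?_)
  exact ne_top_of_le_ne_top hμ (setLIntegral_le_lintegral _ _)

lemma Confining.ae_le_effectivePotential (hV : Confining V q b M) (hd : 2 ≤ d)
    {μ : ProbabilityMeasure (Space d)}
    (hμ : shiftedEnergy V M (μ : Measure (Space d)) ≠ ⊤)
    (hmin : ∀ ρ : ProbabilityMeasure (Space d),
      shiftedEnergy V M (μ : Measure (Space d)) ≤ shiftedEnergy V M (ρ : Measure (Space d))) :
    ∀ᵐ x ∂(μ : Measure (Space d)),
      ∫⁻ x, effectivePotential V M (μ : Measure (Space d)) x ∂(μ : Measure (Space d)) ≤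
        effectivePotential V M (μ : Measure (Space d)) x := by
  have hmeas := (hV.lowerSemicontinuous_effectivePotential hd (μ : Measure (Space d))).measurable
  set C := ∫⁻ x, effectivePotential V M (μ : Measure (Space d)) x ∂(μ : Measure (Space d))
  set N := {x | effectivePotential V M (μ : Measure (Space d)) x < C} with hN
  have hNm : MeasurableSet N := measurableSet_lt hmeas measurable_const
  by_contra hcon
  have hpos : (μ : Measure (Space d)) N ≠ 0 := by
    intro h0
    refine hcon ?_
    rw [ae_iff]
    simpa only [not_le] using h0
  have hinv : ((μ : Measure (Space d)) N)⁻¹ ≠ ⊤ := ENNReal.inv_ne_top.2 hpos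
  set ν : ProbabilityMeasure (Space d) :=
    ⟨((μ : Measure (Space d)) N)⁻¹ • (μ : Measure (Space d)).restrict N, ⟨by
      rw [Measure.smul_apply, Measure.restrict_apply_univ, smul_eq_mul,
        ENNReal.inv_mul_cancel hpos (measure_ne_top _ _)]⟩⟩
  refine hV.not_ae_effectivePotential_lt hd (ν := ν) hμ hmin
    (mutualEnergy_smul_restrict_ne_top (mutualEnergy_ne_top hμ) N hinv) ?_
  exact Measure.ae_smul_measure (ae_restrict_mem hNm) _

lemma Confining.effectivePotential_le_of_mem_support (hV : Confining V q b M) (hd : 2 ≤ d)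
    {μ : ProbabilityMeasure (Space d)}
    (hμ : shiftedEnergy V M (μ : Measure (Space d)) ≠ ⊤)
    (hmin : ∀ ρ : ProbabilityMeasure (Space d),
      shiftedEnergy V M (μ : Measure (Space d)) ≤ shiftedEnergy V M (ρ : Measure (Space d)))
    {x : Space d} (hx : x ∈ (μ : Measure (Space d)).support) :
    effectivePotential V M (μ : Measure (Space d)) x ≤
      ∫⁻ x, effectivePotential V M (μ : Measure (Space d)) x ∂(μ : Measure (Space d)) := by
  have hlsc := hV.lowerSemicontinuous_effectivePotential hd (μ : Measure (Space d))
  have hae := hV.ae_le_effectivePotential hd hμ hmin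
  have hCt : ∫⁻ x, effectivePotential V M (μ : Measure (Space d)) x ∂(μ : Measure (Space d)) ≠ ⊤ := by
    rw [hV.lintegral_effectivePotential hd]
    exact ENNReal.add_ne_top.2 ⟨ENNReal.mul_ne_top ENNReal.ofNat_ne_top (mutualEnergy_ne_top hμ),
      lintegral_shiftedPotential_ne_top hμ⟩
  set C := ∫⁻ x, effectivePotential V M (μ : Measure (Space d)) x ∂(μ : Measure (Space d)) with hC
  have heq : (fun _ => C) =ᵐ[(μ : Measure (Space d))]
      effectivePotential V M (μ : Measure (Space d)) := by
    refine ae_eq_of_ae_le_of_lintegral_le hae (by simpa using hCt) hlsc.measurable.aemeasurable ?_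
    simp [← hC]
  by_contra hlt
  have hopen := hlsc.isOpen_preimage C
  have hpos := (Measure.mem_support_iff_forall x).1 hx _ (hopen.mem_nhds (not_le.1 hlt))
  refine hpos.ne' (measure_mono_null (fun y hy => ?_) (ae_iff.1 heq))
  exact (ne_of_lt (show C < effectivePotential V M (μ : Measure (Space d)) y from hy))

lemma Confining.isCompact_support (hV : Confining V q b M) (hd : 2 ≤ d)
    {μ : ProbabilityMeasure (Space d)}
    (hμ : shiftedEnergy V M (μ : Measure (Space d)) ≠ ⊤)
    (hmin : ∀ ρ : ProbabilityMeasure (Space d),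
      shiftedEnergy V M (μ : Measure (Space d)) ≤ shiftedEnergy V M (ρ : Measure (Space d))) :
    IsCompact (μ : Measure (Space d)).support := by
  have hCt : ∫⁻ x, effectivePotential V M (μ : Measure (Space d)) x ∂(μ : Measure (Space d)) ≠ ⊤ := by
    rw [hV.lintegral_effectivePotential hd]
    exact ENNReal.add_ne_top.2 ⟨ENNReal.mul_ne_top ENNReal.ofNat_ne_top (mutualEnergy_ne_top hμ),
      lintegral_shiftedPotential_ne_top hμ⟩
  obtain ⟨C, hC⟩ : ∃ C : ℝ, ∫⁻ x, effectivePotential V M (μ : Measure (Space d)) x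
      ∂(μ : Measure (Space d)) = ENNReal.ofReal C := ⟨_, (ENNReal.ofReal_toReal hCt).symm⟩
  obtain ⟨C', hC', h⟩ := exists_le_mul_rpow_add hV.one_lt hV.pos
  refine (isCompact_closedBall (0 : Space d) (max C 0 + C')).of_isClosed_subset
    Measure.isClosed_support fun x hx => ?_
  have h1 := hV.effectivePotential_le_of_mem_support hd hμ hmin hx
  have h2 : shiftedPotential V M x ≤ ENNReal.ofReal (max C 0) :=
    (le_add_self.trans (h1.trans_eq hC)).trans (ENNReal.ofReal_le_ofReal (le_max_left _ _))
  have h3 := (ENNReal.ofReal_le_ofReal_iff (le_max_right C 0)).1 h2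
  rw [Metric.mem_closedBall, dist_zero_right]
  have h4 := h ‖x‖ (norm_nonneg x)
  have h5 := hV.le x
  linarith

lemma Confining.two_mul_potential_add (hV : Confining V q b M) (hd : 2 ≤ d)
    {μ : ProbabilityMeasure (Space d)}
    (hμ : Integrable logWeight (μ : Measure (Space d))) (x : Space d) :
    2 * potential μ x + ((V x : ℝ) : EReal) =
      (effectivePotential V M (μ : Measure (Space d)) x : EReal) -
        ((M + 2 * ∫ y, logWeight y ∂(μ : Measure (Space d)) : ℝ) : EReal) := by
  rw [potential_eq hd hμ, effectivePotential, posPotential, shiftedPotential]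
  have h0 := hV.nonneg_shift x
  generalize ∫⁻ y, posKernel d (x, y) ∂(μ : Measure (Space d)) = P
  generalize ∫ y, logWeight y ∂(μ : Measure (Space d)) = H
  by_cases hP : P = ⊤
  · subst hP
    rw [ENNReal.mul_top two_ne_zero, top_add, EReal.coe_ennreal_top, EReal.top_sub_coe,
      EReal.top_sub_coe, EReal.mul_top_of_pos (by norm_num), EReal.top_add_coe]
  · rw [coe_ennreal_sub_coe_eq hP, coe_ennreal_sub_coe_eq (by finiteness),
      ENNReal.toReal_add (by finiteness) ENNReal.ofReal_ne_top, ENNReal.toReal_mul,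
      ENNReal.toReal_ofReal h0]
    have h2 : (2 : EReal) = ((2 : ℝ) : EReal) := rfl
    rw [h2, ← EReal.coe_mul, ← EReal.coe_add, EReal.coe_eq_coe_iff]
    simp only [ENNReal.toReal_ofNat]
    ring

/-- The Euler-Lagrange conditions for the unconstrained minimizer of the energy. -/
theorem Confining.exists_euler_lagrange (hV : Confining V q b M) (hd : 2 ≤ d)
    {μ : ProbabilityMeasure (Space d)}
    (hμ : shiftedEnergy V M (μ : Measure (Space d)) ≠ ⊤)
    (hmin : ∀ ρ : ProbabilityMeasure (Space d),
      shiftedEnergy V M (μ : Measure (Space d)) ≤ shiftedEnergy V M (ρ : Measure (Space d))) :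
    ∃ C : ℝ, (C : EReal) = energy V μ + interaction μ ∧
      QuasiEverywhere (fun x => x ∈ (μ : Measure (Space d)).support →
        2 * potential μ x + ((V x : ℝ) : EReal) = C) ∧
      QuasiEverywhere (fun x => (C : EReal) ≤ 2 * potential μ x + ((V x : ℝ) : EReal)) := by
  have hlog := hV.integrable_logWeight (lintegral_shiftedPotential_ne_top hμ)
  have hI := mutualEnergy_ne_top hμ
  have hCt : ∫⁻ x, effectivePotential V M (μ : Measure (Space d)) x ∂(μ : Measure (Space d)) ≠ ⊤ := by
    rw [hV.lintegral_effectivePotential hd]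
    exact ENNReal.add_ne_top.2 ⟨ENNReal.mul_ne_top ENNReal.ofNat_ne_top hI,
      lintegral_shiftedPotential_ne_top hμ⟩
  have hsupp := fun x => hV.effectivePotential_le_of_mem_support hd hμ hmin (x := x)
  have hcap := hV.not_hasPositiveCapacity hd hμ hmin
  have hCeq := hV.lintegral_effectivePotential hd (μ : Measure (Space d)) (μ : Measure (Space d))
  have hNm : MeasurableSet {x | effectivePotential V M (μ : Measure (Space d)) x <
      ∫⁻ x, effectivePotential V M (μ : Measure (Space d)) x ∂(μ : Measure (Space d))} :=
    measurableSet_lt (hV.lowerSemicontinuous_effectivePotential hd _).measurable measurable_const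
  set C := ∫⁻ x, effectivePotential V M (μ : Measure (Space d)) x ∂(μ : Measure (Space d))
  set S := M + 2 * ∫ y, logWeight y ∂(μ : Measure (Space d))
  have hle : ∀ x, x ∉ {x | effectivePotential V M (μ : Measure (Space d)) x < C} →
      ((C.toReal - S : ℝ) : EReal) ≤ 2 * potential μ x + ((V x : ℝ) : EReal) := fun x hx => by
    rw [hV.two_mul_potential_add hd hlog, ← coe_ennreal_sub_coe_eq hCt,
      coe_ennreal_sub_coe_le_iff]
    exact not_lt.1 hx
  refine ⟨C.toReal - S, ?_, ⟨_, hNm, hcap, fun x hx hxs => le_antisymm ?_ (hle x hx)⟩,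
    ⟨_, hNm, hcap, hle⟩⟩
  · rw [hV.energy_eq hd, interaction_eq hd hlog, coe_ennreal_sub_coe_eq hμ,
      coe_ennreal_sub_coe_eq hI, ← EReal.coe_add, EReal.coe_eq_coe_iff, hCeq, shiftedEnergy,
      ENNReal.toReal_add (by finiteness) (lintegral_shiftedPotential_ne_top hμ),
      ENNReal.toReal_add hI (lintegral_shiftedPotential_ne_top hμ), ENNReal.toReal_mul]
    simp only [ENNReal.toReal_ofNat, S]
    ring
  · rw [hV.two_mul_potential_add hd hlog, ← coe_ennreal_sub_coe_eq hCt,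
      coe_ennreal_sub_coe_le_iff]
    exact hsupp x hxs

end EulerLagrange

section Wasserstein

variable {d : ℕ} {p : ℝ}

instance PSpace.isProbabilityMeasure_meas (μ : PSpace d p) : IsProbabilityMeasure μ.meas :=
  inferInstanceAs (IsProbabilityMeasure (μ.1 : Measure (Space d)))

lemma integrable_norm_of_lintegral_rpow_lt_top (hp : 1 < p) {μ : Measure (Space d)}
    [IsFiniteMeasure μ] (h : ∫⁻ x, ‖x‖ₑ ^ p ∂μ < ⊤) : Integrable (fun x => ‖x‖) μ := by
  have h1 : Integrable (fun x => ‖x‖ ^ p) μ := by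
    refine ⟨Measurable.aestronglyMeasurable (by fun_prop), ?_⟩
    rw [hasFiniteIntegral_iff_ofReal (ae_of_all _ fun x => by positivity)]
    refine lt_of_le_of_lt (lintegral_mono fun x => ?_) h
    rw [← ofReal_norm, ENNReal.ofReal_rpow_of_nonneg (norm_nonneg x) (by linarith)]
  obtain ⟨C, hC, h2⟩ := exists_le_mul_rpow_add hp one_pos
  refine ((h1.const_mul 1).add (integrable_const C)).mono' (by fun_prop) (ae_of_all _ fun x => ?_)
  rw [norm_norm]
  exact h2 _ (norm_nonneg x)

lemma PSpace.integrable_lipschitz (hp : 1 < p) {φ : Space d → ℝ} {L : ℝ≥0}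
    (hφ : LipschitzWith L φ) (μ : PSpace d p) : Integrable φ μ.meas :=
  CoulombGas.integrable_lipschitz hφ (integrable_norm_of_lintegral_rpow_lt_top hp μ.2)

lemma lintegral_enorm_le_rpow (hp : 1 < p) {Ω : Type*} [MeasurableSpace Ω] {m : Measure Ω}
    [IsProbabilityMeasure m] {f : Ω → Space d} (hf : AEStronglyMeasurable f m) :
    ∫⁻ z, ‖f z‖ₑ ∂m ≤ (∫⁻ z, ‖f z‖ₑ ^ p ∂m) ^ (1 / p) := by
  have h := eLpNorm_le_eLpNorm_of_exponent_le (p := 1) (q := ENNReal.ofReal p)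
    (by rw [ENNReal.one_le_ofReal]; exact hp.le) hf
  rw [eLpNorm_one_eq_lintegral_enorm, eLpNorm_eq_lintegral_rpow_enorm_toReal
    (by rw [Ne, ENNReal.ofReal_eq_zero, not_le]; linarith) ENNReal.ofReal_ne_top,
    ENNReal.toReal_ofReal (by linarith)] at h
  exact h

/-- Lipschitz observables are controlled by the Wasserstein distance. -/
lemma abs_integral_sub_integral_le (hp : 1 < p) {φ : Space d → ℝ} {L : ℝ≥0}
    (hφ : LipschitzWith L φ) (μ ν : PSpace d p) {c : ℝ} (hc : 0 ≤ c)
    (h : wasserstein μ ν < ENNReal.ofReal c) :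
    |∫ x, φ x ∂μ.meas - ∫ x, φ x ∂ν.meas| ≤ L * c := by
  have hp0 : 0 < p := by linarith
  rw [wasserstein, one_div, ENNReal.rpow_inv_lt_iff hp0] at h
  simp only [iInf_lt_iff] at h
  obtain ⟨π, ⟨hπ1, hπ2⟩, hπ⟩ := h
  have hprob : IsProbabilityMeasure π := by
    refine ⟨?_⟩
    have h1 : π.map Prod.fst univ = 1 := by rw [hπ1]; exact measure_univ
    rwa [Measure.map_apply measurable_fst MeasurableSet.univ, preimage_univ] at h1
  have hW : ∫⁻ z, ‖z.1 - z.2‖ₑ ∂π ≤ ENNReal.ofReal c := by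
    refine (lintegral_enorm_le_rpow hp
      (f := fun z : Space d × Space d => z.1 - z.2) (by fun_prop)).trans ?_
    rw [one_div, ENNReal.rpow_inv_le_iff hp0]
    exact hπ.le
  have hφm := hφ.continuous.measurable
  have i1 : Integrable (fun z : Space d × Space d => φ z.1) π := by
    have := μ.integrable_lipschitz hp hφ
    rw [← hπ1] at this
    exact this.comp_measurable measurable_fst
  have i2 : Integrable (fun z : Space d × Space d => φ z.2) π := by
    have := ν.integrable_lipschitz hp hφ
    rw [← hπ2] at this
    exact this.comp_measurable measurable_snd
  have e1 : ∫ x, φ x ∂μ.meas = ∫ z, φ z.1 ∂π := by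
    rw [← hπ1, integral_map measurable_fst.aemeasurable hφm.aestronglyMeasurable]
  have e2 : ∫ x, φ x ∂ν.meas = ∫ z, φ z.2 ∂π := by
    rw [← hπ2, integral_map measurable_snd.aemeasurable hφm.aestronglyMeasurable]
  rw [e1, e2, ← integral_sub i1 i2]
  have h1 : ‖∫ z, (φ z.1 - φ z.2) ∂π‖ₑ ≤ L * ENNReal.ofReal c := by
    refine (enorm_integral_le_lintegral_enorm _).trans ?_
    refine (lintegral_mono (g := fun z => (L : ℝ≥0∞) * ‖z.1 - z.2‖ₑ) fun z => ?_).trans ?_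
    · have := hφ.edist_le_mul z.1 z.2
      rwa [edist_eq_enorm_sub, edist_eq_enorm_sub] at this
    · rw [lintegral_const_mul' _ _ ENNReal.coe_ne_top]
      gcongr
  rw [← ofReal_norm, ← ENNReal.ofReal_coe_nnreal, ← ENNReal.ofReal_mul L.coe_nonneg,
    ENNReal.ofReal_le_ofReal_iff (mul_nonneg L.coe_nonneg hc)] at h1
  exact h1

lemma isOpen_integral_pos (hp : 1 < p) {φ : Space d → ℝ} {L : ℝ≥0} (hφ : LipschitzWith L φ) :
    IsOpen {ν : PSpace d p | 0 < ∫ x, φ x ∂ν.meas} := by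
  intro μ hμ
  have hμ' : 0 < ∫ x, φ x ∂μ.meas := hμ
  have hL : (0 : ℝ) ≤ L := L.2
  have hc : 0 < (∫ x, φ x ∂μ.meas) / (L + 1) := by positivity
  refine ⟨ENNReal.ofReal ((∫ x, φ x ∂μ.meas) / (L + 1)), ENNReal.ofReal_pos.2 hc,
    fun ν hν => ?_⟩
  have h := abs_integral_sub_integral_le hp hφ μ ν hc.le hν
  have h1 := le_abs_self (∫ x, φ x ∂μ.meas - ∫ x, φ x ∂ν.meas)
  have h2 : L * ((∫ x, φ x ∂μ.meas) / (L + 1)) < ∫ x, φ x ∂μ.meas := by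
    rw [mul_div_assoc', div_lt_iff₀ (by positivity)]
    nlinarith
  show 0 < ∫ x, φ x ∂ν.meas
  linarith

lemma isOpen_integral_neg (hp : 1 < p) {φ : Space d → ℝ} {L : ℝ≥0} (hφ : LipschitzWith L φ) :
    IsOpen {ν : PSpace d p | ∫ x, φ x ∂ν.meas < 0} := by
  have h := isOpen_integral_pos (d := d) hp hφ.neg
  have heq : {ν : PSpace d p | 0 < ∫ x, (-φ) x ∂ν.meas} =
      {ν : PSpace d p | ∫ x, φ x ∂ν.meas < 0} := by
    ext ν
    simp only [Pi.neg_apply, integral_neg, mem_ofPred_eq, Left.neg_pos_iff]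
  rwa [heq] at h

lemma isClosed_constraintSet (hp : 1 < p) {φ : Space d → ℝ} {L : ℝ≥0} (hφ : LipschitzWith L φ) :
    IsClosed (constraintSet (d := d) p φ) := by
  rw [← isOpen_compl_iff]
  have heq : (constraintSet (d := d) p φ)ᶜ = {ν : PSpace d p | 0 < ∫ x, φ x ∂ν.meas} := by
    ext ν
    simp only [constraintSet, mem_compl_iff, mem_ofPred_eq, not_le]
  rw [heq]
  exact isOpen_integral_pos hp hφ

lemma setOf_integral_neg_subset_interior (hp : 1 < p) {φ : Space d → ℝ} {L : ℝ≥0}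
    (hφ : LipschitzWith L φ) :
    {ν : PSpace d p | ∫ x, φ x ∂ν.meas < 0} ⊆ interior (constraintSet p φ) :=
  interior_maximal (fun ν hν => show ∫ x, φ x ∂ν.meas ≤ 0 from
    le_of_lt (show ∫ x, φ x ∂ν.meas < 0 from hν)) (isOpen_integral_neg hp hφ)

end Wasserstein

section Multiplier

/-- Existence of a Lagrange multiplier for a convex problem with one inequality constraint. -/
lemma exists_multiplier {S : Set (ℝ × ℝ)} {e : ℝ}
    (hconv : ∀ x ∈ S, ∀ y ∈ S, ∀ s t : ℝ, 0 ≤ s → 0 ≤ t → s + t = 1 →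
      ∃ z ∈ S, z.1 = s * x.1 + t * y.1 ∧ z.2 ≤ s * x.2 + t * y.2)
    (he : ∀ z ∈ S, z.1 ≤ 0 → e ≤ z.2) (hslater : ∃ z ∈ S, z.1 < 0) :
    ∃ α : ℝ, 0 ≤ α ∧ ∀ z ∈ S, e ≤ z.2 + α * z.1 := by
  set T : Set ℝ := insert 0 ((fun z : ℝ × ℝ => (e - z.2) / z.1) '' {z ∈ S | 0 < z.1}) with hT
  have hub : ∀ y ∈ S, y.1 < 0 → ∀ r ∈ T, r ≤ (y.2 - e) / (-y.1) := by
    rintro y hy hy1 r (rfl | ⟨x, ⟨hx, hx1⟩, rfl⟩)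
    · have := he y hy hy1.le
      exact div_nonneg (by linarith) (by linarith)
    · have hpos : 0 < x.1 - y.1 := by linarith
      obtain ⟨z, hz, hz1, hz2⟩ := hconv x hx y hy (-y.1 / (x.1 - y.1)) (x.1 / (x.1 - y.1))
        (div_nonneg (by linarith) hpos.le) (by positivity) (by field_simp; ring)
      have hz0 : z.1 = 0 := by rw [hz1]; field_simp; ring
      have h1 := (he z hz hz0.le).trans hz2
      have h2 : -y.1 / (x.1 - y.1) * x.2 + x.1 / (x.1 - y.1) * y.2 =
          (-y.1 * x.2 + x.1 * y.2) / (x.1 - y.1) := by ring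
      rw [h2, le_div_iff₀ hpos] at h1
      simp only
      rw [div_le_div_iff₀ hx1 (by linarith)]
      linarith
  obtain ⟨y, hy, hy1⟩ := hslater
  have hbdd : BddAbove T := ⟨_, hub y hy hy1⟩
  refine ⟨sSup T, le_csSup hbdd (mem_insert _ _), fun z hz => ?_⟩
  rcases lt_trichotomy z.1 0 with h | h | h
  · have h1 : sSup T ≤ (z.2 - e) / (-z.1) := csSup_le ⟨0, mem_insert _ _⟩ (hub z hz h)
    rw [le_div_iff₀ (by linarith)] at h1
    linarith
  · have := he z hz h.le
    rw [h]
    linarith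
  · have h1 : (e - z.2) / z.1 ≤ sSup T :=
      le_csSup hbdd (mem_insert_of_mem _ ⟨z, ⟨hz, h⟩, rfl⟩)
    rw [div_le_iff₀ h] at h1
    linarith

end Multiplier

section Constrained

variable {d : ℕ} {V W φ : Space d → ℝ} {p q b b' M M' α : ℝ} {L : ℝ≥0}

lemma Confining.integrable_shift (hV : Confining V q b M) {μ : Measure (Space d)}
    (h : ∫⁻ x, shiftedPotential V M x ∂μ ≠ ⊤) :
    Integrable (fun x => V x - 2 * logWeight x + M) μ ∧
      (∫⁻ x, shiftedPotential V M x ∂μ).toReal = ∫ x, (V x - 2 * logWeight x + M) ∂μ := by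
  have hm : Measurable fun x => V x - 2 * logWeight x + M := by
    have h1 := hV.lsc.measurable
    have h2 := (continuous_logWeight (d := d)).measurable
    fun_prop
  constructor
  · refine ⟨hm.aestronglyMeasurable, ?_⟩
    rw [hasFiniteIntegral_iff_ofReal (ae_of_all _ hV.nonneg_shift)]
    exact h.lt_top
  · rw [integral_eq_lintegral_of_nonneg_ae (ae_of_all _ hV.nonneg_shift)
      hm.aestronglyMeasurable]
    rfl

lemma Confining.shiftedEnergy_add (hV : Confining V q b M) (hW : Confining W q b' M')
    (hφ : LipschitzWith L φ) (hWV : ∀ x, W x = V x + α * φ x)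
    {μ : Measure (Space d)} [IsProbabilityMeasure μ] (h : shiftedEnergy V M μ ≠ ⊤) :
    shiftedEnergy W M' μ ≠ ⊤ ∧ (shiftedEnergy W M' μ).toReal =
      (shiftedEnergy V M μ).toReal + α * ∫ x, φ x ∂μ + (M' - M) := by
  have hI := mutualEnergy_ne_top h
  have hP := lintegral_shiftedPotential_ne_top h
  obtain ⟨h1, h2⟩ := hV.integrable_shift hP
  have h3 := (integrable_lipschitz hφ (hV.integrable_norm hP)).const_mul α
  have h4 : Integrable (fun x => (V x - 2 * logWeight x + M) + α * φ x + (M' - M)) μ :=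
    (h1.add h3).add (integrable_const _)
  have heq : (fun x => W x - 2 * logWeight x + M') =
      fun x => (V x - 2 * logWeight x + M) + α * φ x + (M' - M) := by
    funext x
    rw [hWV]
    ring
  have h5 : Integrable (fun x => W x - 2 * logWeight x + M') μ := heq ▸ h4
  have hPW : ∫⁻ x, shiftedPotential W M' x ∂μ ≠ ⊤ := by
    have := h5.2
    rw [hasFiniteIntegral_iff_ofReal (ae_of_all _ hW.nonneg_shift)] at this
    exact this.ne
  refine ⟨ENNReal.add_ne_top.2 ⟨hI, hPW⟩, ?_⟩
  rw [shiftedEnergy, shiftedEnergy, ENNReal.toReal_add hI hPW, ENNReal.toReal_add hI hP,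
    (hW.integrable_shift hPW).2, h2, heq,
    integral_add (f := fun x => (V x - 2 * logWeight x + M) + α * φ x) (h1.add h3)
      (integrable_const _), integral_add h1 h3, integral_const_mul, integral_const]
  simp
  ring

lemma Confining.integrable_lipschitz (hV : Confining V q b M) (hφ : LipschitzWith L φ)
    {μ : Measure (Space d)} [IsProbabilityMeasure μ] (h : shiftedEnergy V M μ ≠ ⊤) :
    Integrable φ μ :=
  CoulombGas.integrable_lipschitz hφ (hV.integrable_norm (lintegral_shiftedPotential_ne_top h))

/-- Mixtures of two measures of finite energy. -/
lemma Confining.exists_mix (hV : Confining V q b M) (hd : 2 ≤ d) (hφ : LipschitzWith L φ)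
    {μ ν : ProbabilityMeasure (Space d)}
    (hμ : shiftedEnergy V M (μ : Measure (Space d)) ≠ ⊤)
    (hν : shiftedEnergy V M (ν : Measure (Space d)) ≠ ⊤) {s t : ℝ} (hs : 0 ≤ s) (ht : 0 ≤ t)
    (hst : s + t = 1) :
    ∃ ρ : ProbabilityMeasure (Space d), shiftedEnergy V M (ρ : Measure (Space d)) ≠ ⊤ ∧
      ∫ x, φ x ∂(ρ : Measure (Space d)) = s * ∫ x, φ x ∂(μ : Measure (Space d))
        + t * ∫ x, φ x ∂(ν : Measure (Space d)) ∧
      (shiftedEnergy V M (ρ : Measure (Space d))).toReal ≤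
        s * (shiftedEnergy V M (μ : Measure (Space d))).toReal
          + t * (shiftedEnergy V M (ν : Measure (Space d))).toReal := by
  have h1 : ENNReal.ofReal s + ENNReal.ofReal t = 1 := by
    rw [← ENNReal.ofReal_add hs ht, hst, ENNReal.ofReal_one]
  have h2 := hV.shiftedEnergy_mix_le hd _ _ h1 hμ hν
  have h3 : ENNReal.ofReal s * shiftedEnergy V M (μ : Measure (Space d))
      + ENNReal.ofReal t * shiftedEnergy V M (ν : Measure (Space d)) ≠ ⊤ := by finiteness
  refine ⟨mix _ _ h1 μ ν, ne_top_of_le_ne_top h3 h2, ?_, ?_⟩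
  · rw [coe_mix, integral_add_measure, integral_smul_measure, integral_smul_measure,
      ENNReal.toReal_ofReal hs, ENNReal.toReal_ofReal ht, smul_eq_mul, smul_eq_mul]
    · exact (hV.integrable_lipschitz hφ hμ).smul_measure ENNReal.ofReal_ne_top
    · exact (hV.integrable_lipschitz hφ hν).smul_measure ENNReal.ofReal_ne_top
  · have h4 := ENNReal.toReal_mono h3 h2
    rwa [ENNReal.toReal_add (by finiteness) (by finiteness), ENNReal.toReal_mul,
      ENNReal.toReal_mul, ENNReal.toReal_ofReal hs, ENNReal.toReal_ofReal ht] at h4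

lemma Confining.lintegral_enorm_rpow_lt_top (hV : Confining V q b M) (hp : 0 < p) (hpq : p ≤ q)
    {μ : Measure (Space d)} [IsProbabilityMeasure μ] (h : shiftedEnergy V M μ ≠ ⊤) :
    ∫⁻ x, ‖x‖ₑ ^ p ∂μ < ⊤ := by
  have h1 : ∫⁻ x, (1 + ENNReal.ofReal (‖x‖ ^ q)) ∂μ < ⊤ := by
    rw [lintegral_add_left measurable_const, lintegral_one, measure_univ]
    refine ENNReal.add_lt_top.2 ⟨ENNReal.one_lt_top, ?_⟩
    exact (hV.lintegral_rpow_norm_le μ).trans_lt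
      (ENNReal.mul_lt_top ENNReal.ofReal_lt_top h.lt_top)
  refine lt_of_le_of_lt (lintegral_mono fun x => ?_) h1
  rw [← ofReal_norm, ENNReal.ofReal_rpow_of_nonneg (norm_nonneg x) hp.le,
    ← ENNReal.ofReal_one, ← ENNReal.ofReal_add zero_le_one (by positivity)]
  refine ENNReal.ofReal_le_ofReal ?_
  have h0 : 0 ≤ ‖x‖ ^ q := by positivity
  rcases le_total ‖x‖ 1 with h2 | h2
  · have := Real.rpow_le_one (norm_nonneg x) h2 hp.le
    linarith
  · have := Real.rpow_le_rpow_of_exponent_le h2 hpq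
    linarith

lemma Confining.energy_lt_top_iff (hV : Confining V q b M) (hd : 2 ≤ d)
    (μ : ProbabilityMeasure (Space d)) :
    energy V μ < ⊤ ↔ shiftedEnergy V M (μ : Measure (Space d)) ≠ ⊤ := by
  rw [hV.energy_eq hd, coe_ennreal_sub_coe_lt_top_iff]

lemma Confining.energy_le_iff (hV : Confining V q b M) (hd : 2 ≤ d)
    (μ ν : ProbabilityMeasure (Space d)) :
    energy V μ ≤ energy V ν ↔
      shiftedEnergy V M (μ : Measure (Space d)) ≤ shiftedEnergy V M (ν : Measure (Space d)) := by
  rw [hV.energy_eq hd, hV.energy_eq hd, coe_ennreal_sub_coe_le_iff]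

lemma Confining.energy_eq_coe (hV : Confining V q b M) (hd : 2 ≤ d)
    {μ : ProbabilityMeasure (Space d)} (h : shiftedEnergy V M (μ : Measure (Space d)) ≠ ⊤) :
    energy V μ = (((shiftedEnergy V M (μ : Measure (Space d))).toReal - M : ℝ) : EReal) := by
  rw [hV.energy_eq hd, coe_ennreal_sub_coe_eq h]

/-- Uniqueness of the minimizer of the energy over a set stable under midpoints. -/
lemma Confining.eq_of_minimizer (hV : Confining V q b M) (hd : 2 ≤ d)
    {A : Set (ProbabilityMeasure (Space d))} {μ ν : ProbabilityMeasure (Space d)}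
    (hμ : shiftedEnergy V M (μ : Measure (Space d)) ≠ ⊤)
    (hmix : mix 2⁻¹ 2⁻¹ ENNReal.inv_two_add_inv_two μ ν ∈ A)
    (hmin : ∀ ρ ∈ A, shiftedEnergy V M (μ : Measure (Space d)) ≤
      shiftedEnergy V M (ρ : Measure (Space d)))
    (hν : shiftedEnergy V M (μ : Measure (Space d)) = shiftedEnergy V M (ν : Measure (Space d))) :
    μ = ν := by
  by_contra hne
  exact absurd (hV.exists_shiftedEnergy_mix_lt hd hμ hν hne) (not_lt.2 (hmin _ hmix))

lemma integral_mix_half_nonpos {μ ν : ProbabilityMeasure (Space d)}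
    (hμi : Integrable φ (μ : Measure (Space d))) (hνi : Integrable φ (ν : Measure (Space d)))
    (hμ : ∫ x, φ x ∂(μ : Measure (Space d)) ≤ 0) (hν : ∫ x, φ x ∂(ν : Measure (Space d)) ≤ 0) :
    ∫ x, φ x ∂(mix 2⁻¹ 2⁻¹ ENNReal.inv_two_add_inv_two μ ν : Measure (Space d)) ≤ 0 := by
  rw [coe_mix, integral_add_measure (hμi.smul_measure (by simp)) (hνi.smul_measure (by simp)),
    integral_smul_measure, integral_smul_measure, smul_eq_mul, smul_eq_mul, ← mul_add]
  exact mul_nonpos_of_nonneg_of_nonpos ENNReal.toReal_nonneg (by linarith)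

end Constrained

section Assembly

variable {d : ℕ} {V φ : Space d → ℝ} {p q b M : ℝ} {L : ℝ≥0}

/-- The unconstrained equilibrium measure. -/
lemma Confining.exists_equilibrium (hV : Confining V q b M) (hd : 2 ≤ d)
    (hne : ∃ μ : ProbabilityMeasure (Space d), shiftedEnergy V M (μ : Measure (Space d)) ≠ ⊤) :
    ∃ μ : ProbabilityMeasure (Space d), shiftedEnergy V M (μ : Measure (Space d)) ≠ ⊤ ∧
      (∀ ν : ProbabilityMeasure (Space d), shiftedEnergy V M (μ : Measure (Space d)) ≤
        shiftedEnergy V M (ν : Measure (Space d))) ∧ equilibriumMeasures V = {μ} := by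
  obtain ⟨μ, -, hμ, hmin⟩ := hV.exists_minimizer hd (A := univ)
    (fun c _ => by
      rw [univ_inter]
      exact (hV.lowerSemicontinuous_shiftedEnergy hd).isClosed_preimage c)
    (hne.imp fun μ hμ => ⟨mem_univ _, hμ⟩)
  refine ⟨μ, hμ, fun ν => hmin ν (mem_univ ν), ?_⟩
  refine eq_singleton_iff_unique_mem.2 ⟨fun ν => ?_, fun ν hν => ?_⟩
  · exact (hV.energy_le_iff hd _ _).2 (hmin ν (mem_univ ν))
  · refine (hV.eq_of_minimizer hd (A := univ) hμ (mem_univ _) hmin (le_antisymm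
      (hmin ν (mem_univ ν)) ?_)).symm
    exact (hV.energy_le_iff hd _ _).1 (hν μ)

/-- The constrained equilibrium measure. -/
lemma Confining.exists_constrained_minimizer (hV : Confining V q b M) (hd : 2 ≤ d)
    (hp : 0 < p) (hpq : p ≤ q) (hφ : LipschitzWith L φ)
    (hne : ∃ μ : ProbabilityMeasure (Space d), shiftedEnergy V M (μ : Measure (Space d)) ≠ ⊤ ∧
      ∫ x, φ x ∂(μ : Measure (Space d)) ≤ 0) :
    ∃ μ : PSpace d p, shiftedEnergy V M μ.meas ≠ ⊤ ∧ ∫ x, φ x ∂μ.meas ≤ 0 ∧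
      (∀ ν : ProbabilityMeasure (Space d), ∫ x, φ x ∂(ν : Measure (Space d)) ≤ 0 →
        shiftedEnergy V M μ.meas ≤ shiftedEnergy V M (ν : Measure (Space d))) ∧
      infEnergy V (constraintSet p φ) = energy V μ.toProb ∧
      minimizers V (constraintSet p φ) = {μ} := by
  obtain ⟨μ, hμφ, hμ, hmin⟩ := hV.exists_minimizer hd
    (A := {μ : ProbabilityMeasure (Space d) | ∫ x, φ x ∂(μ : Measure (Space d)) ≤ 0})
    (fun c hc => hV.isClosed_constraint hd hφ hc)
    (hne.imp fun μ hμ => ⟨hμ.2, hμ.1⟩)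
  set μ' : PSpace d p := ⟨μ, hV.lintegral_enorm_rpow_lt_top hp hpq hμ⟩ with hμ'
  have hinf : infEnergy V (constraintSet p φ) = energy V μ'.toProb := by
    refine le_antisymm (iInf₂_le μ' hμφ) (le_iInf₂ fun ν hν => ?_)
    exact (hV.energy_le_iff hd _ _).2 (hmin ν.toProb hν)
  refine ⟨μ', hμ, hμφ, hmin, hinf, ?_⟩
  refine eq_singleton_iff_unique_mem.2 ⟨⟨hμφ, hinf.symm⟩, fun ν hν => ?_⟩
  obtain ⟨hνφ, hνe⟩ := hν
  have heq : shiftedEnergy V M (μ : Measure (Space d)) =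
      shiftedEnergy V M (ν.toProb : Measure (Space d)) :=
    le_antisymm (hmin ν.toProb hνφ) ((hV.energy_le_iff hd _ _).1 (hνe.trans hinf).le)
  refine Subtype.ext (hV.eq_of_minimizer hd hμ ?_ hmin heq).symm
  exact integral_mix_half_nonpos (hV.integrable_lipschitz hφ hμ)
    (hV.integrable_lipschitz hφ (heq ▸ hμ)) hμφ hνφ

/-- The Lagrange multiplier of the constrained equilibrium problem. -/
lemma Confining.exists_lagrange_multiplier (hV : Confining V q b M) (hd : 2 ≤ d)
    (hφ : LipschitzWith L φ) {μstar μ : ProbabilityMeasure (Space d)}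
    (hstar : shiftedEnergy V M (μstar : Measure (Space d)) ≠ ⊤)
    (hstarmin : ∀ ν : ProbabilityMeasure (Space d),
      shiftedEnergy V M (μstar : Measure (Space d)) ≤ shiftedEnergy V M (ν : Measure (Space d)))
    (hμ : shiftedEnergy V M (μ : Measure (Space d)) ≠ ⊤)
    (hμφ : ∫ x, φ x ∂(μ : Measure (Space d)) ≤ 0)
    (hmin : ∀ ν : ProbabilityMeasure (Space d), ∫ x, φ x ∂(ν : Measure (Space d)) ≤ 0 →
        shiftedEnergy V M (μ : Measure (Space d)) ≤ shiftedEnergy V M (ν : Measure (Space d)))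
    (hneg : ∃ ν : ProbabilityMeasure (Space d), shiftedEnergy V M (ν : Measure (Space d)) ≠ ⊤ ∧
      ∫ x, φ x ∂(ν : Measure (Space d)) < 0) :
    ∃ α : ℝ, 0 ≤ α ∧ α * ∫ x, φ x ∂(μ : Measure (Space d)) = 0 ∧
      (∀ ν : ProbabilityMeasure (Space d), shiftedEnergy V M (ν : Measure (Space d)) ≠ ⊤ →
        (shiftedEnergy V M (μ : Measure (Space d))).toReal ≤
          (shiftedEnergy V M (ν : Measure (Space d))).toReal
            + α * ∫ x, φ x ∂(ν : Measure (Space d))) ∧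
      ((∫ x, φ x ∂(μstar : Measure (Space d)) ≤ 0 ∧ α = 0) ∨
        (¬ ∫ x, φ x ∂(μstar : Measure (Space d)) ≤ 0 ∧
          ∫ x, φ x ∂(μ : Measure (Space d)) = 0 ∧ 0 < α)) := by
  by_cases hB : ∫ x, φ x ∂(μstar : Measure (Space d)) ≤ 0
  · refine ⟨0, le_rfl, zero_mul _, fun ν hν => ?_, Or.inl ⟨hB, rfl⟩⟩
    rw [zero_mul, add_zero]
    exact ENNReal.toReal_mono hν ((hmin μstar hB).trans (hstarmin ν))
  set S : Set (ℝ × ℝ) := {z | ∃ ν : ProbabilityMeasure (Space d),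
    shiftedEnergy V M (ν : Measure (Space d)) ≠ ⊤ ∧
      z = (∫ x, φ x ∂(ν : Measure (Space d)),
        (shiftedEnergy V M (ν : Measure (Space d))).toReal)}
  obtain ⟨α, hα, h⟩ := exists_multiplier (S := S)
    (e := (shiftedEnergy V M (μ : Measure (Space d))).toReal)
    (by
      rintro _ ⟨ν, hν, rfl⟩ _ ⟨ρ, hρ, rfl⟩ s t hs ht hst
      obtain ⟨η, h1, h2, h3⟩ := hV.exists_mix hd hφ hν hρ hs ht hst
      exact ⟨_, ⟨η, h1, rfl⟩, h2, h3⟩)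
    (by
      rintro _ ⟨ν, hν, rfl⟩ h
      exact ENNReal.toReal_mono hν (hmin ν h))
    (by
      obtain ⟨ν, hν, hlt⟩ := hneg
      exact ⟨_, ⟨ν, hν, rfl⟩, hlt⟩)
  have h' : ∀ ν : ProbabilityMeasure (Space d), shiftedEnergy V M (ν : Measure (Space d)) ≠ ⊤ →
      (shiftedEnergy V M (μ : Measure (Space d))).toReal ≤
        (shiftedEnergy V M (ν : Measure (Space d))).toReal
          + α * ∫ x, φ x ∂(ν : Measure (Space d)) := fun ν hν => h _ ⟨ν, hν, rfl⟩
  rw [not_le] at hB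
  have hlt : (shiftedEnergy V M (μstar : Measure (Space d))).toReal <
      (shiftedEnergy V M (μ : Measure (Space d))).toReal := by
    refine (ENNReal.toReal_lt_toReal hstar hμ).2 (lt_of_le_of_ne (hstarmin μ) fun heq => ?_)
    have := hV.eq_of_minimizer hd (A := univ) hstar (mem_univ _) (fun ρ _ => hstarmin ρ) heq
    rw [this] at hB
    linarith
  have hα0 : 0 < α := by
    refine lt_of_le_of_ne hα fun h0 => ?_
    have := h' μstar hstar
    rw [← h0, zero_mul, add_zero] at this
    linarith
  have hφ0 : ∫ x, φ x ∂(μ : Measure (Space d)) = 0 := by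
    have := h' μ hμ
    refine le_antisymm hμφ (nonneg_of_mul_nonneg_right ?_ hα0)
    linarith
  exact ⟨α, hα, by rw [hφ0, mul_zero], h', Or.inr ⟨not_le.2 hB, hφ0, hα0⟩⟩

/-- The constraint set is an energy-continuity set. -/
lemma Confining.infEnergy_interior (hV : Confining V q b M) (hd : 2 ≤ d)
    (hp : 1 < p) (hpq : p ≤ q) (hφ : LipschitzWith L φ) {μ : PSpace d p}
    (hμ : shiftedEnergy V M μ.meas ≠ ⊤) (hμφ : ∫ x, φ x ∂μ.meas ≤ 0)
    (hinf : infEnergy V (constraintSet p φ) = energy V μ.toProb)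
    (hneg : ∃ ν : ProbabilityMeasure (Space d), shiftedEnergy V M (ν : Measure (Space d)) ≠ ⊤ ∧
      ∫ x, φ x ∂(ν : Measure (Space d)) < 0) :
    infEnergy V (interior (constraintSet p φ)) = infEnergy V (constraintSet p φ) := by
  refine le_antisymm ?_ (biInf_mono interior_subset)
  obtain ⟨ν, hν, hνφ⟩ := hneg
  rw [hinf, hV.energy_eq_coe hd hμ]
  set A := (shiftedEnergy V M (μ.toProb : Measure (Space d))).toReal
  set B := (shiftedEnergy V M (ν : Measure (Space d))).toReal
  have hle : ∀ n : ℕ, infEnergy V (interior (constraintSet p φ)) ≤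
      ((A + 1 / ((n : ℝ) + 1) * (B - A) - M : ℝ) : EReal) := by
    intro n
    have ht := one_div_succ_pos n
    obtain ⟨ρ, h1, h2, h3⟩ := hV.exists_mix hd hφ (μ := μ.toProb) hμ hν
      (sub_nonneg.2 (one_div_succ_le_one n)) ht.le (sub_add_cancel _ _)
    set ρ' : PSpace d p := ⟨ρ, hV.lintegral_enorm_rpow_lt_top (by linarith) hpq h1⟩
    have hρ : ρ' ∈ interior (constraintSet p φ) := by
      refine setOf_integral_neg_subset_interior hp hφ ?_
      show ∫ x, φ x ∂(ρ : Measure (Space d)) < 0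
      rw [h2]
      have h4 := mul_nonpos_of_nonneg_of_nonpos (sub_nonneg.2 (one_div_succ_le_one n)) hμφ
      have h5 := mul_neg_of_pos_of_neg ht hνφ
      exact add_neg_of_nonpos_of_neg h4 h5
    refine (iInf₂_le ρ' hρ).trans ?_
    rw [show ρ'.toProb = ρ from rfl, hV.energy_eq_coe hd h1, EReal.coe_le_coe_iff]
    refine sub_le_sub_right (h3.trans_eq ?_) M
    ring
  refine ge_of_tendsto' (x := atTop) ?_ hle
  refine (continuous_coe_real_ereal.tendsto _).comp ?_
  have h0 : A - M = A + 0 * (B - A) - M := by ring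
  rw [h0]
  exact ((tendsto_one_div_add_atTop_nhds_zero_nat.mul_const (B - A)).const_add A).sub_const M

end Assembly

end CoulombGas

end

open CoulombGas in
theorem theorem3p6 (d : ℕ) (hd : 2 ≤ d)
    (V : CoulombGas.Space d → ℝ) (hV : LowerSemicontinuous V)
    (a R q : ℝ) (ha : 0 < a) (hq : 1 < q) (hgrowth : ∀ x, a * ‖x‖ ^ q - R ≤ V x)
    (p : ℝ) (hp : 1 < p) (hpq : p < q)
    (φ : CoulombGas.Space d → ℝ) (hφ : ∃ L : ℝ≥0, LipschitzWith L φ)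
    (hneg : ∃ μ : ProbabilityMeasure (CoulombGas.Space d),
      CoulombGas.energy V μ < ⊤ ∧ ∫ x, φ x ∂(μ : Measure (CoulombGas.Space d)) < 0)
    (hpos : ∃ μ : ProbabilityMeasure (CoulombGas.Space d),
      CoulombGas.energy V μ < ⊤ ∧ 0 < ∫ x, φ x ∂(μ : Measure (CoulombGas.Space d))) :
    -- `B` is closed and an energy-continuity set for the `p`-Wasserstein topology
    IsClosed (CoulombGas.constraintSet p φ) ∧
    CoulombGas.infEnergy V (interior (CoulombGas.constraintSet p φ)) =
      CoulombGas.infEnergy V (CoulombGas.constraintSet p φ) ∧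
    CoulombGas.infEnergy V (CoulombGas.constraintSet p φ) < ⊤ ∧
    -- the unconstrained equilibrium measure
    ∃ μstar : CoulombGas.PSpace d p,
      CoulombGas.equilibriumMeasures V = {μstar.toProb} ∧ IsCompact μstar.meas.support ∧
      -- the constrained equilibrium measure
      ∃ μφ : CoulombGas.PSpace d p,
        CoulombGas.minimizers V (CoulombGas.constraintSet p φ) = {μφ} ∧
        IsCompact μφ.meas.support ∧
        -- the Lagrange multiplier and the constant of the Euler-Lagrange conditions
        ∃ α C : ℝ, 0 ≤ α ∧
          (C : EReal) = CoulombGas.energy V μφ.toProb + CoulombGas.interaction μφ.toProb ∧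
          CoulombGas.QuasiEverywhere (fun x => x ∈ μφ.meas.support →
            2 * CoulombGas.potential μφ.toProb x + ((V x + α * φ x : ℝ) : EReal) = C) ∧
          CoulombGas.QuasiEverywhere (fun x =>
            (C : EReal) ≤
              2 * CoulombGas.potential μφ.toProb x + ((V x + α * φ x : ℝ) : EReal)) ∧
          ((μstar ∈ CoulombGas.constraintSet p φ ∧ α = 0) ∨
            (μstar ∉ CoulombGas.constraintSet p φ ∧ ∫ x, φ x ∂μφ.meas = 0 ∧ 0 < α)) := by
  obtain ⟨L, hL⟩ := hφ
  obtain ⟨M, hVM⟩ := exists_confining hV ha hq hgrowth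
  have hneg' : ∃ ν : ProbabilityMeasure (Space d),
      shiftedEnergy V M (ν : Measure (Space d)) ≠ ⊤ ∧
        ∫ x, φ x ∂(ν : Measure (Space d)) < 0 :=
    hneg.imp fun ν hν => ⟨(hVM.energy_lt_top_iff hd ν).1 hν.1, hν.2⟩
  obtain ⟨μs, hs, hsmin, hseq⟩ := hVM.exists_equilibrium hd (hneg'.imp fun ν hν => hν.1)
  obtain ⟨μφ, hμ, hμφ, hmin, hinf, hminim⟩ := hVM.exists_constrained_minimizer hd
    (p := p) (by linarith) hpq.le hL (hneg'.imp fun ν hν => ⟨hν.1, hν.2.le⟩)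
  obtain ⟨α, hα, hαφ, hαmin, halt⟩ := hVM.exists_lagrange_multiplier hd hL hs hsmin
    (μ := μφ.toProb) hμ hμφ hmin hneg'
  obtain ⟨R', hR'⟩ := exists_growth_add_lipschitz ha hq hgrowth hL hα
  obtain ⟨M', hW⟩ := exists_confining (V := fun x => V x + α * φ x)
    (hV.add (continuous_const.mul hL.continuous).lowerSemicontinuous) (half_pos ha) hq hR'
  obtain ⟨hWμ, hWe⟩ := hVM.shiftedEnergy_add hW (α := α) hL (fun _ => rfl)
    (μ := (μφ.toProb : Measure (Space d))) hμ
  have hWmin : ∀ ρ : ProbabilityMeasure (Space d),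
      shiftedEnergy (fun x => V x + α * φ x) M' (μφ.toProb : Measure (Space d)) ≤
        shiftedEnergy (fun x => V x + α * φ x) M' (ρ : Measure (Space d)) := by
    intro ρ
    by_cases hρ : shiftedEnergy (fun x => V x + α * φ x) M' (ρ : Measure (Space d)) = ⊤
    · rw [hρ]
      exact le_top
    · obtain ⟨h1, h2⟩ := hW.shiftedEnergy_add hVM (α := -α) hL (fun x => by ring) hρ
      have h3 := hαmin ρ h1
      rw [← ENNReal.toReal_le_toReal hWμ hρ, hWe, hαφ]
      linarith
  obtain ⟨C, hC, hEL1, hEL2⟩ := hW.exists_euler_lagrange hd hWμ hWmin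
  refine ⟨isClosed_constraintSet hp hL, hVM.infEnergy_interior hd hp hpq.le hL hμ hμφ hinf hneg',
    ?_, ⟨μs, hVM.lintegral_enorm_rpow_lt_top (by linarith) hpq.le hs⟩, hseq,
    hVM.isCompact_support hd hs hsmin, μφ, hminim, hW.isCompact_support hd hWμ hWmin, α, C, hα,
    ?_, hEL1, hEL2, halt⟩
  · rw [hinf]
    exact (hVM.energy_lt_top_iff hd _).2 hμ
  · rw [hC, hW.energy_eq_coe hd hWμ, hVM.energy_eq_coe hd (μ := μφ.toProb) hμ, hWe, hαφ]
    congr 2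
    ring
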